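/- Let $d_1,d_2>0$ and $c\in\mathbb R$. Three agents with positions $p_1,p_2,p_3\in\mathbb R^2$, relative positions $z_1=p_1-p_2\neq 0$, $z_2=p_2-p_3\neq 0$, unit vectors $\hat z_k=z_k/\|z_k\|$ and distance errors $e_k=\|z_k\|-d_k$ move according to the biased flexible formation with $\mu_1=-\mu_2=c$: $$\dot p_1=-\hat z_1e_1,\qquad \dot p_2=\hat z_1e_1-\hat z_2e_2+\mu_1\hat z_1+\mu_2\hat z_2,\qquad \dot p_3=\hat z_2e_2 .$$ Then $(z,e)=(z_1,z_2,e_1,e_2)$ satisfies the closed-loop system $$\begin{aligned}\dot z_1&=-2\hat z_1e_1+\hat z_2e_2-c\hat z_1+c\hat z_2, & \dot e_1&=-2e_1+\hat z_1^T\hat z_2\,e_2-c+c\,\hat z_1^T\hat z_2,\\ \dot z_2&=-2\hat z_2e_2+\hat z_1e_1+c\hat z_1-c\hat z_2, & \dot e_2&=-2e_2+\hat z_2^T\hat z_1\,e_1-c+c\,\hat z_2^T\hat z_1,\end{aligned}$$ on the states with $z_k\ne0$, $e_k=\|z_k\|-d_k$. As long as also $z_3=p_3-p_1\neq0$, for every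 $d_3$ the error vector $(e_1,e_2,e_3)$ with $e_3=\|z_3\|-d_3$ satisfies the augmented error system (with $l_k=e_k+d_k$) $$\begin{aligned}\dot e_1&=-2e_1-c+\tfrac{(e_2+c)(l_3^2-l_1^2-l_2^2)}{2l_1l_2},\qquad \dot e_2=-2e_2-c+\tfrac{(e_1+c)(l_3^2-l_1^2-l_2^2)}{2l_1l_2},\\ \dot e_3&=\tfrac{e_1(l_2^2-l_1^2-l_3^2)}{2l_1l_3}+\tfrac{e_2(l_1^2-l_2^2-l_3^2)}{2l_2l_3}.\end{aligned}$$ Consider the sets of states $$\mathcal U_d=\{e_1=e_2=0,\ \hat z_1=\hat z_2\},\qquad \mathcal U_u=\{e_1=e_2=-\tfrac{2c}{3},\ \hat z_1=-\hat z_2\}.$$ Both consist of equilibria of the closed-loop system. The agents are at rest on $\mathcal U_d$, and on $\mathcal U_u$ all three have velocity $\tfrac{2c}{3}\hat z_1$. Moreover, for the closed-loop system: 1. If $c>0$, then $\mathcal U_d$ is locally exponentially stable, and $\mathcal U_u$ is unstable provided $\tfrac{2c}{3}<\min(d_1,d_2)$ (that is, provided $\mathcal U_u\neq\emptyset$). 2.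 If $c<0$, then $\mathcal U_d$ is unstable and $\mathcal U_u$ is locally exponentially stable. Here a set $A$ of states is stable if for every $\varepsilon>0$ there is $\delta>0$ such that every solution starting at distance less than $\delta$ from $A$ stays at distance less than $\varepsilon$ from $A$ as long as it exists; it is unstable if it is not stable; and it is locally exponentially stable if it is non-empty and there are $\delta,K,r>0$ such that from every state $x_0$ with $\operatorname{dist}(x_0,A)<\delta$ there starts a solution on $[0,\infty)$, and every solution $x$ with $x(0)=x_0$ satisfies $\operatorname{dist}(x(t),A)\le Ke^{-rt}\operatorname{dist}(x_0,A)$ as long as it exists. Finally, for every $c\in\mathbb R$, the augmented error system with $d_3=d_1+d_2$ has $e=0$ (which corresponds to $\mathcal U_d$) as an equilibrium, it is differentiable there, and its Jacobian at $e=0$ has characteristic polynomial $(\lambda+1)(\lambda+3)(\lambda+2ca)$ with $a=\frac{d_1+d_2}{d_1d_2}$. -/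

import Mathlib

open Set Polynomial

namespace FlexibleFormation

noncomputable section

/-! ### Stability of sets for an autonomous differential equation

`M` is the state space (a subset of the ambient normed space `X`), `F` the vector field. -/

section Stability

variable {X : Type*} [NormedAddCommGroup X] [NormedSpace ℝ X]

/-- `x` solves `x' = F x` on the time set `I`, and stays in the state space `M` there. -/
def IsSolutionOn (M : Set X) (F : X → X) (I : Set ℝ) (x : ℝ → X) : Prop :=
  ∀ t ∈ I, x t ∈ M ∧ HasDerivWithinAt x (F (x t)) I t

/-- Lyapunov stability of the set `A`: solutions that start close to `A` stay close to `A`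
for as long as they exist. -/
def IsStableSet (M : Set X) (F : X → X) (A : Set X) : Prop :=
  ∀ ε > 0, ∃ δ > 0, ∀ T ≥ 0, ∀ x : ℝ → X, IsSolutionOn M F (Icc 0 T) x →
    Metric.infDist (x 0) A < δ → ∀ t ∈ Icc 0 T, Metric.infDist (x t) A < ε

/-- Instability of `A`: there is an `ε > 0` such that arbitrarily close to `A` there start
solutions that reach the distance `ε` from `A`. -/
def IsUnstableSet (M : Set X) (F : X → X) (A : Set X) : Prop :=
  ¬ IsStableSet M F A

/-- Local exponential stability of the (nonempty) set `A`: from every state close enough to `A`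
there starts a solution defined for all `t ≥ 0`, and the distance to `A` of every solution
starting there is at most `K e^{-r t}` times the initial distance, with uniform `K, r > 0`. -/
def IsLocallyExpStableSet (M : Set X) (F : X → X) (A : Set X) : Prop :=
  A.Nonempty ∧ ∃ δ > 0, ∃ K > 0, ∃ r > 0, ∀ x₀ ∈ M, Metric.infDist x₀ A < δ →
    (∃ x : ℝ → X, x 0 = x₀ ∧ IsSolutionOn M F (Ici 0) x) ∧
    ∀ T ≥ 0, ∀ x : ℝ → X, x 0 = x₀ → IsSolutionOn M F (Icc 0 T) x →
      ∀ t ∈ Icc 0 T, Metric.infDist (x t) A ≤ K * Real.exp (-r * t) * Metric.infDist x₀ A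

end Stability

/-! ### The three agents in the plane -/

/-- The Euclidean plane. -/
abbrev Plane := EuclideanSpace ℝ (Fin 2)

/-- Positions `(p₁, p₂, p₃)` of the three agents. -/
abbrev Positions := Plane × Plane × Plane

/-- Relative positions and distance errors `(z₁, z₂, e₁, e₂)`. -/
abbrev RelState := Plane × Plane × ℝ × ℝ

/-- The unit vector `ẑ = z / ‖z‖` (used for `z ≠ 0` only). -/
def dirVec (z : Plane) : Plane := ‖z‖⁻¹ • z

/-- The pair `(z, e)` of a configuration: `z₁ = p₁ - p₂`, `z₂ = p₂ - p₃`, `eₖ = ‖zₖ‖ - dₖ`. -/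
def relState (d₁ d₂ : ℝ) (p : Positions) : RelState :=
  (p.1 - p.2.1, p.2.1 - p.2.2, ‖p.1 - p.2.1‖ - d₁, ‖p.2.1 - p.2.2‖ - d₂)

/-- Configurations at which the two measured directions `ẑ₁`, `ẑ₂` are defined. -/
def positionSpace : Set Positions := {p | p.1 ≠ p.2.1 ∧ p.2.1 ≠ p.2.2}

/-- Velocities of the agents as functions of the state `(z, e)`, with biases `μ₁`, `μ₂`:
`p₁' = -ẑ₁ e₁`, `p₂' = ẑ₁ e₁ - ẑ₂ e₂ + μ₁ ẑ₁ + μ₂ ẑ₂`, `p₃' = ẑ₂ e₂`. -/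
def biasedVelocity (μ₁ μ₂ : ℝ) (z₁ z₂ : Plane) (e₁ e₂ : ℝ) : Positions :=
  (-(e₁ • dirVec z₁),
   e₁ • dirVec z₁ - e₂ • dirVec z₂ + μ₁ • dirVec z₁ + μ₂ • dirVec z₂,
   e₂ • dirVec z₂)

/-- The biased flexible formation: the vector field on positions. -/
def biasedField (d₁ d₂ μ₁ μ₂ : ℝ) (p : Positions) : Positions :=
  biasedVelocity μ₁ μ₂ (p.1 - p.2.1) (p.2.1 - p.2.2) (‖p.1 - p.2.1‖ - d₁) (‖p.2.1 - p.2.2‖ - d₂)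

/-! ### The closed-loop system for `(z, e)` -/

/-- The states of the closed loop: `zₖ ≠ 0`, and `eₖ` is the distance error of `zₖ`. -/
def relSpace (d₁ d₂ : ℝ) : Set RelState :=
  {x | x.1 ≠ 0 ∧ x.2.1 ≠ 0 ∧ x.2.2.1 = ‖x.1‖ - d₁ ∧ x.2.2.2 = ‖x.2.1‖ - d₂}

/-- Right-hand sides for `z₁'`, `z₂'`, `e₁'`, `e₂'` under the biases `μ₁ = -μ₂ = c`. -/
def closedLoopRHS (c : ℝ) (z₁ z₂ : Plane) (e₁ e₂ : ℝ) : RelState :=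
  (-(2 * e₁) • dirVec z₁ + e₂ • dirVec z₂ - c • dirVec z₁ + c • dirVec z₂,
   -(2 * e₂) • dirVec z₂ + e₁ • dirVec z₁ + c • dirVec z₁ - c • dirVec z₂,
   -2 * e₁ + inner ℝ (dirVec z₁) (dirVec z₂) * e₂ - c + c * inner ℝ (dirVec z₁) (dirVec z₂),
   -2 * e₂ + inner ℝ (dirVec z₂) (dirVec z₁) * e₁ - c + c * inner ℝ (dirVec z₂) (dirVec z₁))

/-- The vector field of the closed loop. -/
def closedLoopField (c : ℝ) (x : RelState) : RelState :=
  closedLoopRHS c x.1 x.2.1 x.2.2.1 x.2.2.2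

/-- The collinear set `𝒰_d`: `e₁ = e₂ = 0` and `ẑ₁ = ẑ₂`. -/
def Ud (d₁ d₂ : ℝ) : Set RelState :=
  {x | x ∈ relSpace d₁ d₂ ∧ (x.2.2.1 = 0 ∧ x.2.2.2 = 0) ∧ dirVec x.1 = dirVec x.2.1}

/-- The collinear set `𝒰_u`: `e₁ = e₂ = -2c/3` and `ẑ₁ = -ẑ₂`. -/
def Uu (d₁ d₂ c : ℝ) : Set RelState :=
  {x | x ∈ relSpace d₁ d₂ ∧ (x.2.2.1 = -(2 * c / 3) ∧ x.2.2.2 = -(2 * c / 3)) ∧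
    dirVec x.1 = -dirVec x.2.1}

/-! ### The augmented error system -/

/-- The three errors `eₖ = ‖zₖ‖ - dₖ` of a configuration, with `z₃ = p₃ - p₁`. -/
def augmentedError (d₁ d₂ d₃ : ℝ) (p : Positions) : Fin 3 → ℝ :=
  ![‖p.1 - p.2.1‖ - d₁, ‖p.2.1 - p.2.2‖ - d₂, ‖p.2.2 - p.1‖ - d₃]

/-- The autonomous error system, in the side lengths `l₁ = e₁ + d₁`, `l₂ = e₂ + d₂`,
`l₃ = e₃ + d₃`. -/
def augmentedRHS (c e₁ e₂ l₁ l₂ l₃ : ℝ) : Fin 3 → ℝ :=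
  ![-2 * e₁ - c + (e₂ + c) * (l₃ ^ 2 - l₁ ^ 2 - l₂ ^ 2) / (2 * l₁ * l₂),
    -2 * e₂ - c + (e₁ + c) * (l₃ ^ 2 - l₁ ^ 2 - l₂ ^ 2) / (2 * l₁ * l₂),
    e₁ * (l₂ ^ 2 - l₁ ^ 2 - l₃ ^ 2) / (2 * l₁ * l₃)
      + e₂ * (l₁ ^ 2 - l₂ ^ 2 - l₃ ^ 2) / (2 * l₂ * l₃)]

/-- The vector field of the augmented error system. -/
def augmentedField (d₁ d₂ d₃ c : ℝ) (e : Fin 3 → ℝ) : Fin 3 → ℝ :=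
  augmentedRHS c (e 0) (e 1) (e 0 + d₁) (e 1 + d₂) (e 2 + d₃)

/-- The Jacobian matrix of a vector field on `ℝ³`. -/
def jacobian (F : (Fin 3 → ℝ) → (Fin 3 → ℝ)) (e : Fin 3 → ℝ) : Matrix (Fin 3) (Fin 3) ℝ :=
  LinearMap.toMatrix' (fderiv ℝ F e : (Fin 3 → ℝ) →ₗ[ℝ] (Fin 3 → ℝ))

end

end FlexibleFormation

open FlexibleFormation

/-! With `s` the cosine of the angle between the edges, the closed loop gives `e₁' = -2e₁ - c + s(e₂
+ c)`, symmetrically for `e₂`, and `s' = (1 - s²)((e₂ + c)/‖z₁‖ + (e₁ + c)/‖z₂‖)`. Both collinear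
sets are therefore one object with parameters: `s = σ = ±1` and `e₁ = e₂ = e`, where `-2e - c + σ(e
+ c) = 0`.

In terms of `fₖ = eₖ - e` and `q = 1 - σs ≥ 0`, the linear error dynamics at `q = 0` have
eigenvalues `-1` and `-3`, while `q' = -q(2 - q)S` with `S` close to `σ(e + c)(1/(d₁ + e) + 1/(d₂ +
e))`. The sign of `σ(e + c)` decides: it is `c` on `𝒰_d` and `-c/3` on `𝒰_u`.

If it is positive, `V = f₁² + f₂² + q` decays exponentially (`dissipation`), and `√V` is comparable
to the distance from the set (`infDist_collinearSet_le`, `sqrt_lyapunov_le_infDist`). If it is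
negative, `q` grows exponentially while the state stays close, contradicting stability. Both
arguments need long-lived solutions; `exists_isSolutionOn_closedLoop` provides them whenever the
errors are confined a priori. -/

namespace FlexibleFormation

/-! ### Scalar comparison -/

/-- Grönwall's inequality for `φ' ≤ -r φ`, with any real `r`. -/
theorem le_mul_exp_of_deriv_le {φ φ' : ℝ → ℝ} {r T : ℝ}
    (hφ : ∀ t ∈ Icc 0 T, HasDerivWithinAt φ (φ' t) (Icc 0 T) t)
    (hle : ∀ t ∈ Icc 0 T, φ' t ≤ -r * φ t) {t : ℝ} (ht : t ∈ Icc 0 T) :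
    φ t ≤ φ 0 * Real.exp (-r * t) := by
  have hexp : ∀ s, HasDerivAt (fun s => Real.exp (r * s)) (Real.exp (r * s) * (r * 1)) s :=
    fun s => ((hasDerivAt_id s).const_mul r).exp
  have hder : ∀ s ∈ Icc 0 T, HasDerivWithinAt (fun s => φ s * Real.exp (r * s))
      (φ' s * Real.exp (r * s) + φ s * (Real.exp (r * s) * (r * 1))) (Icc 0 T) s :=
    fun s hs => (hφ s hs).mul (hexp s).hasDerivWithinAt
  have hanti : AntitoneOn (fun s => φ s * Real.exp (r * s)) (Icc 0 T) := by
    refine antitoneOn_of_deriv_nonpos (convex_Icc 0 T) (fun s hs => (hder s hs).continuousWithinAt)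
      (fun s hs => ?_) (fun s hs => ?_)
    · exact ((hder s (interior_subset hs)).mono interior_subset).differentiableWithinAt
    · have hs' := interior_subset hs
      rw [((hder s hs').hasDerivAt (mem_interior_iff_mem_nhds.1 hs)).deriv]
      nlinarith [hle s hs', Real.exp_pos (r * s)]
  have h := hanti ⟨le_rfl, ht.1.trans ht.2⟩ ht ht.1
  simp only [mul_zero, Real.exp_zero, mul_one] at h
  have he : Real.exp (r * t) * Real.exp (-r * t) = 1 := by
    rw [← Real.exp_add]; simp
  calc φ t = φ t * Real.exp (r * t) * Real.exp (-r * t) := by rw [mul_assoc, he, mul_one]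
    _ ≤ φ 0 * Real.exp (-r * t) := by gcongr

/-- A nonnegative function which decays exponentially below the level `η`, and starts below that
level, stays below it and decays. -/
theorem le_mul_exp_of_deriv_le_below {φ φ' : ℝ → ℝ} {r η T : ℝ} (hr : 0 < r)
    (hφ : ∀ t ∈ Icc 0 T, HasDerivWithinAt φ (φ' t) (Icc 0 T) t)
    (hle : ∀ t ∈ Icc 0 T, φ t < η → φ' t ≤ -r * φ t) (hpos : 0 ≤ φ 0) (h0 : φ 0 < η)
    {t : ℝ} (ht : t ∈ Icc 0 T) : φ t < η ∧ φ t ≤ φ 0 * Real.exp (-r * t) := by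
  -- The constant barrier at the midpoint of `φ 0` and `η` is positive and below `η`, so at a
  -- contact the decay hypothesis applies and gives `φ' < 0` strictly.
  have hbelow : ∀ s ∈ Icc 0 T, φ s ≤ (φ 0 + η) / 2 := by
    refine image_le_of_deriv_right_lt_deriv_boundary' (f' := φ') (B' := fun _ => 0)
      (fun s hs => (hφ s hs).continuousWithinAt) (fun s hs => ?_) (by linarith)
      continuousOn_const (fun s _ => hasDerivWithinAt_const _ _ _) (fun s hs hs' => ?_)
    · exact (hφ s (Ico_subset_Icc_self hs)).mono_of_mem_nhdsWithin
        (Icc_mem_nhdsGE_of_mem hs)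
    · refine (hle s (Ico_subset_Icc_self hs) (by rw [hs']; linarith)).trans_lt ?_
      rw [hs']
      nlinarith
  refine ⟨by linarith [hbelow t ht], le_mul_exp_of_deriv_le hφ (fun s hs => ?_) ht⟩
  exact hle s hs (by linarith [hbelow s hs])

/-! ### Existence of global solutions -/

section Existence

variable {E : Type*} [NormedAddCommGroup E] [NormedSpace ℝ E]

/-- A bounded Lipschitz vector field has a solution on every interval `[0, T]`. -/
theorem exists_solution_Icc_of_lipschitzWith [CompleteSpace E] {G : E → E} {K : NNReal}
    (hG : LipschitzWith K G) {L : NNReal} (hb : ∀ x, ‖G x‖ ≤ L) (x₀ : E) {T : ℝ} (hT : 0 ≤ T) :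
    ∃ y : ℝ → E, y 0 = x₀ ∧ ∀ t ∈ Icc 0 T, HasDerivWithinAt y (G (y t)) (Icc 0 T) t := by
  have hpl : IsPicardLindelof (fun _ => G) (⟨0, le_rfl, hT⟩ : Icc (0 : ℝ) T) x₀
      (L * T.toNNReal) 0 L K := by
    refine IsPicardLindelof.of_time_independent (fun x _ => hb x) hG.lipschitzOnWith ?_
    simp [hT]
  exact hpl.exists_eq_forall_mem_Icc_hasDerivWithinAt₀

/-- A bounded Lipschitz vector field has a solution on `[0, ∞)`. -/
theorem exists_solution_Ici_of_lipschitzWith [CompleteSpace E] {G : E → E} {K : NNReal}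
    (hG : LipschitzWith K G) {L : NNReal} (hb : ∀ x, ‖G x‖ ≤ L) (x₀ : E) :
    ∃ y : ℝ → E, y 0 = x₀ ∧ ∀ t ∈ Ici 0, HasDerivWithinAt y (G (y t)) (Ici 0) t := by
  choose y hy0 hy using fun n : ℕ =>
    exists_solution_Icc_of_lipschitzWith hG hb x₀ (Nat.cast_nonneg (α := ℝ) n)
  have hright : ∀ (n : ℕ) (t : ℝ), t ∈ Ico (0 : ℝ) n →
      HasDerivWithinAt (y n) (G (y n t)) (Ici t) t := fun n t ht =>
    (hy n t (Ico_subset_Icc_self ht)).mono_of_mem_nhdsWithin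
      (Icc_mem_nhdsGE_of_mem ht)
  -- By uniqueness the solutions on `[0, n]` extend one another, so reading off `y ⌈t⌉₊ t` glues
  -- them.
  have hagree : ∀ m n : ℕ, m ≤ n → EqOn (y m) (y n) (Icc 0 m) := by
    intro m n hmn
    have hmn' : (m : ℝ) ≤ n := by exact_mod_cast hmn
    refine ODE_solution_unique (v := fun _ => G) (fun _ => hG)
      (fun s hs => (hy m s hs).continuousWithinAt) (hright m)
      (fun s hs => ((hy n s ⟨hs.1, hs.2.trans hmn'⟩).continuousWithinAt).mono
        (Icc_subset_Icc_right hmn'))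
      (fun s hs => hright n s ⟨hs.1, hs.2.trans_le hmn'⟩) ?_
    rw [hy0, hy0]
  have heq : ∀ (n : ℕ) (t : ℝ), t ∈ Icc (0 : ℝ) n → y ⌈t⌉₊ t = y n t := fun n t ht =>
    hagree ⌈t⌉₊ n (Nat.ceil_le.2 ht.2) ⟨ht.1, Nat.le_ceil t⟩
  refine ⟨fun t => y ⌈t⌉₊ t, by simpa using hy0 0, fun t ht => ?_⟩
  have ht0 : (0 : ℝ) ≤ t := ht
  -- The extra `1` makes `t < n` strict, so that `[0, n]` is a neighbourhood of `t` within `[0, ∞)`.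
  set n := ⌈t⌉₊ + 1 with hn
  have htn : t < n := by rw [hn]; push_cast; linarith [Nat.le_ceil t]
  have hmem : Icc (0 : ℝ) n ∈ nhdsWithin t (Ici 0) := by
    rw [← Ici_inter_Iic]
    exact Filter.inter_mem self_mem_nhdsWithin (mem_nhdsWithin_of_mem_nhds (Iic_mem_nhds htn))
  refine HasDerivWithinAt.mono_of_mem_nhdsWithin ?_ hmem
  simp only [heq n t ⟨ht0, htn.le⟩]
  exact (hy n t ⟨ht0, htn.le⟩).congr (fun s hs => heq n s hs) (heq n t ⟨ht0, htn.le⟩)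

/-- A `C¹` vector field on an open set agrees on a given compact subset with a vector field that
is bounded and Lipschitz on the whole space. -/
theorem exists_lipschitzWith_bounded_eqOn [FiniteDimensional ℝ E] {F : E → E} {U K : Set E}
    (hU : IsOpen U) (hK : IsCompact K) (hKU : K ⊆ U) (hF : ContDiffOn ℝ 1 F U) :
    ∃ (G : E → E) (C L : NNReal), LipschitzWith C G ∧ (∀ x, ‖G x‖ ≤ L) ∧ EqOn G F K := by
  -- `F` is multiplied by a `C¹` cutoff `χ` that is `1` on `K` and `0` off a compact `K' ⊆ U`; a
  -- compactly supported `C¹` field is bounded and Lipschitz.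
  obtain ⟨K', hK', hKK', hK'U⟩ := exists_compact_between hK hU hKU
  obtain ⟨χ, hχ1, hχ0, -⟩ := exists_contMDiffMap_one_nhds_of_subset_interior (n := 1)
    (modelWithCornersSelf ℝ E) hK.isClosed hKK'
  have hχ : ContDiff ℝ 1 χ := χ.contMDiff.contDiff
  have hsupp : Function.support (fun x => χ x • F x) ⊆ K' := by
    intro x hx
    by_contra hxK
    exact hx (by simp [hχ0 x hxK])
  have htsupp : tsupport (fun x => χ x • F x) ⊆ K' := closure_minimal hsupp hK'.isClosed
  have hcomp : HasCompactSupport (fun x => χ x • F x) :=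
    HasCompactSupport.of_support_subset_isCompact hK' hsupp
  have hG : ContDiff ℝ 1 (fun x => χ x • F x) := by
    refine contDiff_iff_contDiffAt.2 fun x => ?_
    by_cases hx : x ∈ tsupport (fun x => χ x • F x)
    · exact hχ.contDiffAt.smul (hF.contDiffAt (hU.mem_nhds (hK'U (htsupp hx))))
    · exact contDiffAt_const.congr_of_eventuallyEq (notMem_tsupport_iff_eventuallyEq.1 hx)
  obtain ⟨C, hC⟩ := hG.lipschitzWith_of_hasCompactSupport hcomp one_ne_zero
  obtain ⟨L, hL⟩ := hcomp.exists_bound_of_continuous hG.continuous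
  refine ⟨_, C, L.toNNReal, hC, fun x => (hL x).trans (Real.le_coe_toNNReal L), fun x hx => ?_⟩
  have : χ x = 1 := hχ1.self_of_nhdsSet x hx
  simp [this]

/-- If no solution starting at `x₀` can reach the boundary of the compact set `K`, then there is
a solution on `[0, ∞)` which stays in `K`. -/
theorem exists_isSolutionOn_Ici_of_trapped [FiniteDimensional ℝ E] {F : E → E} {U K : Set E}
    (hU : IsOpen U) (hK : IsCompact K) (hKU : K ⊆ U) (hF : ContDiffOn ℝ 1 F U) {x₀ : E}
    (hx₀ : x₀ ∈ K)
    (htrap : ∀ T ≥ 0, ∀ x : ℝ → E, x 0 = x₀ → IsSolutionOn K F (Icc 0 T) x → x T ∈ interior K) :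
    ∃ x : ℝ → E, x 0 = x₀ ∧ IsSolutionOn K F (Ici 0) x := by
  have : CompleteSpace E := FiniteDimensional.complete ℝ E
  obtain ⟨G, C, L, hG, hL, hGF⟩ := exists_lipschitzWith_bounded_eqOn hU hK hKU hF
  obtain ⟨y, hy0, hy⟩ := exists_solution_Ici_of_lipschitzWith hG hL x₀
  have hcont : ContinuousOn y (Ici 0) := fun t ht => (hy t ht).continuousWithinAt
  have htrap' : ∀ T ≥ 0, (∀ t ∈ Icc 0 T, y t ∈ K) → y T ∈ interior K := by
    intro T hT hyK
    refine htrap T hT y hy0 fun t ht => ⟨hyK t ht, ?_⟩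
    rw [← hGF (hyK t ht)]
    exact (hy t ht.1).mono Icc_subset_Ici_self
  have hstay : ∀ t ∈ Ici (0 : ℝ), y t ∈ interior K := by
    by_contra! hexit
    obtain ⟨t₁, ht₁, hyt₁⟩ := hexit
    -- `sInf B` would be the first time outside the interior. Up to and including that time `y` lies
    -- in the closed set `K`, so it solves the original equation and trapping puts it back in the
    -- interior.
    set B := Ici (0 : ℝ) ∩ y ⁻¹' (interior K)ᶜ with hB
    have hBc : IsClosed B := hcont.preimage_isClosed_of_isClosed isClosed_Ici
      isOpen_interior.isClosed_compl
    have hBdd : BddBelow B := ⟨0, fun s hs => hs.1⟩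
    have hmem : sInf B ∈ B := hBc.csInf_mem ⟨t₁, ht₁, hyt₁⟩ hBdd
    have hlt : ∀ s ∈ Ico 0 (sInf B), y s ∈ K := by
      intro s hs
      by_contra hsK
      exact absurd (csInf_le hBdd ⟨hs.1, fun h => hsK (interior_subset h)⟩) (not_le.2 hs.2)
    have h0 : (0 : ℝ) ≤ sInf B := hmem.1
    refine hmem.2 (htrap' _ h0 fun t ht => ?_)
    rcases ht.2.lt_or_eq with h | h
    · exact hlt t ⟨ht.1, h⟩
    · rcases h0.lt_or_eq with h0' | h0'
      · have hclos : t ∈ closure (Ico 0 (sInf B)) := by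
          rw [closure_Ico h0'.ne]; exact ht
        have := ((hcont t ht.1).mono Ico_subset_Ici_self).mem_closure hclos hlt
        rwa [hK.isClosed.closure_eq] at this
      · rw [h, ← h0', hy0]; exact hx₀
  refine ⟨y, hy0, fun t ht => ⟨interior_subset (hstay t ht), ?_⟩⟩
  rw [← hGF (interior_subset (hstay t ht))]
  exact hy t ht

end Existence

end FlexibleFormation

namespace FlexibleFormation

/-! ### Unit vectors -/

theorem norm_dirVec {z : Plane} (hz : z ≠ 0) : ‖dirVec z‖ = 1 := by
  rw [dirVec, norm_smul, norm_inv, norm_norm, inv_mul_cancel₀ (norm_ne_zero_iff.2 hz)]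

theorem norm_smul_dirVec {z : Plane} (hz : z ≠ 0) : ‖z‖ • dirVec z = z := by
  rw [dirVec, smul_smul, mul_inv_cancel₀ (norm_ne_zero_iff.2 hz), one_smul]

theorem inner_dirVec_self {z : Plane} (hz : z ≠ 0) : inner ℝ (dirVec z) (dirVec z) = 1 := by
  rw [real_inner_self_eq_norm_sq, norm_dirVec hz, one_pow]

theorem dirVec_smul_of_pos {l : ℝ} (hl : 0 < l) {u : Plane} (hu : ‖u‖ = 1) :
    dirVec (l • u) = u := by
  rw [dirVec, norm_smul, hu, mul_one, Real.norm_of_nonneg hl.le, smul_smul,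
    inv_mul_cancel₀ hl.ne', one_smul]

/-- The law of cosines, for the vectors along the sides of a triangle. -/
theorem inner_dirVec_of_add_eq_zero {z₁ z₂ z₃ : Plane} (h₁ : z₁ ≠ 0) (h₂ : z₂ ≠ 0)
    (h : z₁ + z₂ + z₃ = 0) :
    inner ℝ (dirVec z₁) (dirVec z₂) =
      (‖z₃‖ ^ 2 - ‖z₁‖ ^ 2 - ‖z₂‖ ^ 2) / (2 * ‖z₁‖ * ‖z₂‖) := by
  have h₁' := norm_ne_zero_iff.2 h₁
  have h₂' := norm_ne_zero_iff.2 h₂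
  have h₃ : ‖z₃‖ = ‖z₁ + z₂‖ := by
    rw [← norm_neg, neg_eq_of_add_eq_zero_left h]
  rw [h₃, norm_add_sq_real, dirVec, dirVec, real_inner_smul_left, real_inner_smul_right]
  field_simp
  ring

/-! ### Derivatives of components, lengths and directions along curves -/

section Components

variable {E F : Type*} [NormedAddCommGroup E] [NormedSpace ℝ E] [NormedAddCommGroup F]
  [NormedSpace ℝ F] {f : ℝ → E × F} {f' : E × F} {I : Set ℝ} {t : ℝ}

theorem hasDerivWithinAt_prod_fst (h : HasDerivWithinAt f f' I t) :
    HasDerivWithinAt (fun s => (f s).1) f'.1 I t := by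
  simpa using (h.hasFDerivWithinAt.fst).hasDerivWithinAt

theorem hasDerivWithinAt_prod_snd (h : HasDerivWithinAt f f' I t) :
    HasDerivWithinAt (fun s => (f s).2) f'.2 I t := by
  simpa using (h.hasFDerivWithinAt.snd).hasDerivWithinAt

end Components

theorem hasDerivWithinAt_norm_plane {z : ℝ → Plane} {z' : Plane} {I : Set ℝ} {t : ℝ}
    (h : HasDerivWithinAt z z' I t) (hz : z t ≠ 0) :
    HasDerivWithinAt (fun s => ‖z s‖) (inner ℝ (dirVec (z t)) z') I t := by
  have hn := norm_ne_zero_iff.2 hz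
  have h2 := h.norm_sq.sqrt (pow_ne_zero 2 hn)
  simp only [Real.sqrt_sq (norm_nonneg _)] at h2
  refine h2.congr_deriv ?_
  rw [dirVec, real_inner_smul_left]
  field_simp

/-- Only the part of the velocity orthogonal to `z` turns the direction, at a rate inversely
proportional to the length. -/
theorem hasDerivWithinAt_dirVec {z : ℝ → Plane} {z' : Plane} {I : Set ℝ} {t : ℝ}
    (h : HasDerivWithinAt z z' I t) (hz : z t ≠ 0) :
    HasDerivWithinAt (fun s => dirVec (z s))
      (‖z t‖⁻¹ • (z' - inner ℝ (dirVec (z t)) z' •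
        dirVec (z t))) I t := by
  have hn := norm_ne_zero_iff.2 hz
  refine (((hasDerivWithinAt_norm_plane h hz).inv hn).smul h).congr_deriv ?_
  have hz' : ((-inner ℝ (dirVec (z t)) z' / ‖z t‖ ^ 2) • z t : Plane) =
      -((‖z t‖⁻¹ * inner ℝ (dirVec (z t)) z') •
        dirVec (z t)) := by
    rw [dirVec, smul_smul, ← neg_smul]
    congr 1
    field_simp
  rw [hz', Pi.inv_apply, smul_sub, smul_smul]
  abel

/-! ### The closed loop and the augmented error system -/

/-- The distance errors follow their equations as soon as the relative positions do. -/
theorem hasDerivWithinAt_closedLoop {d₁ d₂ c : ℝ} {z₁ z₂ : ℝ → Plane} {I : Set ℝ} {t : ℝ}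
    (hz₁ : z₁ t ≠ 0) (hz₂ : z₂ t ≠ 0)
    (h₁ : HasDerivWithinAt z₁
      (closedLoopRHS c (z₁ t) (z₂ t) (‖z₁ t‖ - d₁) (‖z₂ t‖ - d₂)).1 I t)
    (h₂ : HasDerivWithinAt z₂
      (closedLoopRHS c (z₁ t) (z₂ t) (‖z₁ t‖ - d₁) (‖z₂ t‖ - d₂)).2.1 I t) :
    HasDerivWithinAt (fun s => ((z₁ s, z₂ s, ‖z₁ s‖ - d₁, ‖z₂ s‖ - d₂) : RelState))
      (closedLoopField c (z₁ t, z₂ t, ‖z₁ t‖ - d₁, ‖z₂ t‖ - d₂)) I t := by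
  have e₁ := (hasDerivWithinAt_norm_plane h₁ hz₁).sub_const d₁
  have e₂ := (hasDerivWithinAt_norm_plane h₂ hz₂).sub_const d₂
  refine (h₁.prodMk (h₂.prodMk (e₁.prodMk e₂))).congr_deriv ?_
  simp only [closedLoopField, closedLoopRHS, Prod.mk.injEq, true_and]
  simp only [inner_add_right, inner_sub_right, real_inner_smul_right, inner_dirVec_self hz₁,
    inner_dirVec_self hz₂]
  constructor <;> ring

/-- Solutions of the biased formation give solutions of the closed loop. -/
theorem isSolutionOn_relState {d₁ d₂ c : ℝ} {I : Set ℝ} {p : ℝ → Positions}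
    (hp : IsSolutionOn positionSpace (biasedField d₁ d₂ c (-c)) I p) :
    IsSolutionOn (relSpace d₁ d₂) (closedLoopField c) I (fun t => relState d₁ d₂ (p t)) := by
  intro t ht
  obtain ⟨hM, hd⟩ := hp t ht
  have hz₁ : (p t).1 - (p t).2.1 ≠ 0 := sub_ne_zero.2 hM.1
  have hz₂ : (p t).2.1 - (p t).2.2 ≠ 0 := sub_ne_zero.2 hM.2
  refine ⟨⟨hz₁, hz₂, rfl, rfl⟩, ?_⟩
  have hd₁ := (hasDerivWithinAt_prod_fst hd)
  have hd₂ := (hasDerivWithinAt_prod_fst (hasDerivWithinAt_prod_snd hd))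
  have hd₃ := (hasDerivWithinAt_prod_snd (hasDerivWithinAt_prod_snd hd))
  refine hasDerivWithinAt_closedLoop (z₁ := fun s => (p s).1 - (p s).2.1)
    (z₂ := fun s => (p s).2.1 - (p s).2.2) hz₁ hz₂ ((hd₁.sub hd₂).congr_deriv ?_)
    ((hd₂.sub hd₃).congr_deriv ?_)
  all_goals
    simp only [biasedField, biasedVelocity, closedLoopRHS]
    module

/-- Solutions of the biased formation give solutions of the augmented error system. -/
theorem hasDerivWithinAt_augmentedError {d₁ d₂ c : ℝ} {I : Set ℝ} {p : ℝ → Positions}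
    (hp : IsSolutionOn positionSpace (biasedField d₁ d₂ c (-c)) I p) (d₃ : ℝ) {t : ℝ}
    (ht : t ∈ I) (hne : (p t).2.2 ≠ (p t).1) :
    HasDerivWithinAt (fun s => augmentedError d₁ d₂ d₃ (p s))
      (augmentedField d₁ d₂ d₃ c (augmentedError d₁ d₂ d₃ (p t))) I t := by
  obtain ⟨⟨hz₁, hz₂, -, -⟩, hx⟩ := isSolutionOn_relState hp t ht
  obtain ⟨-, hd⟩ := hp t ht
  have hz₃ : (p t).2.2 - (p t).1 ≠ 0 := sub_ne_zero.2 hne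
  have he₁ := (hasDerivWithinAt_prod_fst (hasDerivWithinAt_prod_snd (hasDerivWithinAt_prod_snd hx)))
  have he₂ := (hasDerivWithinAt_prod_snd (hasDerivWithinAt_prod_snd (hasDerivWithinAt_prod_snd hx)))
  have hd₃ : HasDerivWithinAt (fun s => (p s).2.2 - (p s).1) _ I t :=
    (hasDerivWithinAt_prod_snd (hasDerivWithinAt_prod_snd hd)).sub (hasDerivWithinAt_prod_fst hd)
  have he₃ := (hasDerivWithinAt_norm_plane hd₃ hz₃).sub_const d₃
  simp only [relState] at hz₁ hz₂
  -- Since `z₁ + z₂ + z₃ = 0`, all three cosines are functions of the side lengths; this is what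
  -- closes the error system.
  have h12 := inner_dirVec_of_add_eq_zero hz₁ hz₂
    (show _ + _ + ((p t).2.2 - (p t).1) = 0 by abel)
  have h31 := inner_dirVec_of_add_eq_zero hz₃ hz₁
    (show _ + _ + ((p t).2.1 - (p t).2.2) = 0 by abel)
  have h32 := inner_dirVec_of_add_eq_zero hz₃ hz₂
    (show _ + _ + ((p t).1 - (p t).2.1) = 0 by abel)
  have hn₁ := norm_ne_zero_iff.2 hz₁
  have hn₂ := norm_ne_zero_iff.2 hz₂
  have hn₃ := norm_ne_zero_iff.2 hz₃
  refine hasDerivWithinAt_pi.2 fun i => ?_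
  fin_cases i
  · refine he₁.congr_deriv ?_
    simp [augmentedField, augmentedRHS, augmentedError, closedLoopField, closedLoopRHS, relState,
      h12]
    ring
  · refine he₂.congr_deriv ?_
    simp [augmentedField, augmentedRHS, augmentedError, closedLoopField, closedLoopRHS, relState,
      real_inner_comm (dirVec ((p t).1 - (p t).2.1)), h12]
    ring
  · refine he₃.congr_deriv ?_
    simp only [biasedField, biasedVelocity, sub_neg_eq_add, inner_add_right,
      real_inner_smul_right, h31, h32]
    simp [augmentedField, augmentedRHS, augmentedError]
    field_simp
    ring

/-- The angle between the two edges is driven by the errors. -/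
theorem hasDerivWithinAt_cos {d₁ d₂ c : ℝ} {I : Set ℝ} {x : ℝ → RelState}
    (hx : IsSolutionOn (relSpace d₁ d₂) (closedLoopField c) I x) {t : ℝ} (ht : t ∈ I) :
    HasDerivWithinAt (fun s => inner ℝ (dirVec (x s).1) (dirVec (x s).2.1))
      ((1 - inner ℝ (dirVec (x t).1) (dirVec (x t).2.1) ^ 2) *
        (((x t).2.2.2 + c) / ‖(x t).1‖ + ((x t).2.2.1 + c) / ‖(x t).2.1‖)) I t := by
  obtain ⟨⟨hz₁, hz₂, -, -⟩, hd⟩ := hx t ht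
  have hn₁ := norm_ne_zero_iff.2 hz₁
  have hn₂ := norm_ne_zero_iff.2 hz₂
  -- The part of `z₁'` orthogonal to `ẑ₁` is `(e₂ + c)(ẑ₂ - sẑ₁)`, with inner product `(e₂ + c)(1 -
  -- s²)` against `ẑ₂`; the second edge is symmetric.
  refine ((hasDerivWithinAt_dirVec (hasDerivWithinAt_prod_fst hd) hz₁).inner ℝ
    (hasDerivWithinAt_dirVec (hasDerivWithinAt_prod_fst (hasDerivWithinAt_prod_snd hd)) hz₂)).congr_deriv ?_
  simp only [closedLoopField, closedLoopRHS, inner_add_right, inner_sub_right, inner_add_left,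
    inner_sub_left, real_inner_smul_right, real_inner_smul_left, inner_dirVec_self hz₁,
    inner_dirVec_self hz₂, real_inner_comm (dirVec (x t).1) (dirVec (x t).2.1)]
  field_simp
  ring

/-! ### Equilibria -/

theorem closedLoopField_eq_zero_of_mem_Ud {d₁ d₂ c : ℝ} {x : RelState} (hx : x ∈ Ud d₁ d₂) :
    closedLoopField c x = 0 := by
  obtain ⟨⟨hz₁, hz₂, -, -⟩, ⟨h₁, h₂⟩, hu⟩ := hx
  simp only [closedLoopField, closedLoopRHS, h₁, h₂, hu, inner_dirVec_self hz₂]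
  simp

theorem closedLoopField_eq_zero_of_mem_Uu {d₁ d₂ c : ℝ} {x : RelState} (hx : x ∈ Uu d₁ d₂ c) :
    closedLoopField c x = 0 := by
  obtain ⟨⟨hz₁, hz₂, -, -⟩, ⟨h₁, h₂⟩, hu⟩ := hx
  simp only [closedLoopField, closedLoopRHS, h₁, h₂, hu, inner_neg_left, inner_neg_right,
    inner_dirVec_self hz₂, Prod.mk_eq_zero]
  refine ⟨by module, by module, by ring, by ring⟩

theorem biasedField_eq_zero_of_mem_Ud {d₁ d₂ c : ℝ} {p : Positions}
    (hp : relState d₁ d₂ p ∈ Ud d₁ d₂) : biasedField d₁ d₂ c (-c) p = 0 := by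
  obtain ⟨-, ⟨h₁, h₂⟩, hu⟩ := hp
  simp only [relState] at h₁ h₂ hu
  simp [biasedField, biasedVelocity, h₁, h₂, hu]

theorem biasedField_of_mem_Uu {d₁ d₂ c : ℝ} {p : Positions}
    (hp : relState d₁ d₂ p ∈ Uu d₁ d₂ c) :
    biasedField d₁ d₂ c (-c) p =
      ((2 * c / 3) • dirVec (p.1 - p.2.1), (2 * c / 3) • dirVec (p.1 - p.2.1),
        (2 * c / 3) • dirVec (p.1 - p.2.1)) := by
  obtain ⟨-, ⟨h₁, h₂⟩, hu⟩ := hp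
  simp only [relState] at h₁ h₂ hu
  simp only [biasedField, biasedVelocity, h₁, h₂, hu, Prod.mk.injEq]
  refine ⟨by module, by module, by module⟩

/-! ### Linearization of the augmented error system -/

theorem augmentedField_zero {d₁ d₂ : ℝ} (hd₁ : 0 < d₁) (hd₂ : 0 < d₂) (c : ℝ) :
    augmentedField d₁ d₂ (d₁ + d₂) c 0 = 0 := by
  funext i
  fin_cases i <;> simp [augmentedField, augmentedRHS]
  all_goals
    field_simp
    ring

theorem hasFDerivAt_div {E : Type*} [NormedAddCommGroup E] [NormedSpace ℝ E] {f g : E → ℝ}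
    {f' g' : E →L[ℝ] ℝ} {x : E} (hf : HasFDerivAt f f' x) (hg : HasFDerivAt g g' x)
    (hgx : g x ≠ 0) :
    HasFDerivAt (fun y => f y / g y) ((g x)⁻¹ • f' - (f x / g x ^ 2) • g') x := by
  refine (hf.mul ((hasDerivAt_inv hgx).comp_hasFDerivAt x hg)).congr_fderiv ?_
  ext v
  simp
  field_simp
  ring

/-- The linearization of the augmented error system at `e = 0`, for `d₃ = d₁ + d₂`. -/
theorem hasFDerivAt_augmentedField {d₁ d₂ : ℝ} (hd₁ : 0 < d₁) (hd₂ : 0 < d₂) (c : ℝ) :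
    HasFDerivAt (augmentedField d₁ d₂ (d₁ + d₂) c)
      (LinearMap.toContinuousLinearMap (Matrix.toLin'
        !![-2 - c * ((d₁ + d₂) / (d₁ * d₂)), 1 - c * ((d₁ + d₂) / (d₁ * d₂)),
            c * ((d₁ + d₂) / (d₁ * d₂));
          1 - c * ((d₁ + d₂) / (d₁ * d₂)), -2 - c * ((d₁ + d₂) / (d₁ * d₂)),
            c * ((d₁ + d₂) / (d₁ * d₂));
          -1, -1, 0])) 0 := by
  have hc : ∀ i : Fin 3, HasFDerivAt (fun e : Fin 3 → ℝ => e i)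
    (ContinuousLinearMap.proj (R := ℝ) (φ := fun _ : Fin 3 => ℝ) i) 0 :=
    fun i => hasFDerivAt_apply i 0
  have hl₁ := (hc 0).add_const d₁
  have hl₂ := (hc 1).add_const d₂
  have hl₃ := (hc 2).add_const (d₁ + d₂)
  have hd₃ : d₁ + d₂ ≠ 0 := by positivity
  have h12 : 2 * ((0 : Fin 3 → ℝ) 0 + d₁) * ((0 : Fin 3 → ℝ) 1 + d₂) ≠ 0 := by
    simp [hd₁.ne', hd₂.ne']
  have h13 : 2 * ((0 : Fin 3 → ℝ) 0 + d₁) * ((0 : Fin 3 → ℝ) 2 + (d₁ + d₂)) ≠ 0 := by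
    simp [hd₁.ne', hd₃]
  have h23 : 2 * ((0 : Fin 3 → ℝ) 1 + d₂) * ((0 : Fin 3 → ℝ) 2 + (d₁ + d₂)) ≠ 0 := by
    simp [hd₂.ne', hd₃]
  -- At `l₃ = l₁ + l₂` the cosine quotient is `1` with partial derivatives `-a, -a, a`, where `a =
  -- (d₁ + d₂)/(d₁d₂)`. In the third row the errors vanish at `0`, so only their coefficients `-1`
  -- survive.
  have hcos := ((hl₃.pow 2).sub (hl₁.pow 2)).sub (hl₂.pow 2)
  have hden := (hl₁.const_mul 2).mul hl₂
  have f₁ := (((hc 0).const_mul (-2)).sub_const c).add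
    (hasFDerivAt_div (((hc 1).add_const c).mul hcos) hden h12)
  have f₂ := (((hc 1).const_mul (-2)).sub_const c).add
    (hasFDerivAt_div (((hc 0).add_const c).mul hcos) hden h12)
  have f₃ := (hasFDerivAt_div ((hc 0).mul (((hl₂.pow 2).sub (hl₁.pow 2)).sub (hl₃.pow 2)))
      ((hl₁.const_mul 2).mul hl₃) h13).add
    (hasFDerivAt_div ((hc 1).mul (((hl₁.pow 2).sub (hl₂.pow 2)).sub (hl₃.pow 2)))
      ((hl₂.const_mul 2).mul hl₃) h23)
  refine hasFDerivAt_pi'.2 fun i => ?_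
  fin_cases i
  · refine f₁.congr_fderiv ?_
    ext v
    simp [dotProduct, Fin.sum_univ_three]
    field_simp
    ring
  · refine f₂.congr_fderiv ?_
    ext v
    simp [dotProduct, Fin.sum_univ_three]
    field_simp
    ring
  · refine f₃.congr_fderiv ?_
    ext v
    simp [dotProduct, Fin.sum_univ_three]
    field_simp
    ring

/-- The Jacobian respects the exchange of the first two coordinates: `(1, -1, 0)` has eigenvalue
`-3`, and vectors `(x, x, y)` contribute `λ² + (1 + 2ca)λ + 2ca = (λ + 1)(λ + 2ca)`. -/
theorem charpoly_jacobian_augmentedField {d₁ d₂ : ℝ} (hd₁ : 0 < d₁) (hd₂ : 0 < d₂) (c : ℝ) :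
    (jacobian (augmentedField d₁ d₂ (d₁ + d₂) c) 0).charpoly =
      (X + C 1) * (X + C 3) * (X + C (2 * c * ((d₁ + d₂) / (d₁ * d₂)))) := by
  rw [jacobian, (hasFDerivAt_augmentedField hd₁ hd₂ c).fderiv,
    LinearMap.coe_toContinuousLinearMap, LinearMap.toMatrix'_toLin']
  generalize (d₁ + d₂) / (d₁ * d₂) = a
  simp [Matrix.charpoly, Matrix.det_fin_three]
  have h2 : (C 2 : ℝ[X]) = 2 := rfl
  have h3 : (C 3 : ℝ[X]) = 3 := rfl
  rw [h2, h3]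
  ring

end FlexibleFormation

namespace FlexibleFormation

/-! ### Collinear sets and the distance to them -/

/-- The collinear states with both errors equal to `e`, and with parallel (`σ = 1`) or antiparallel
(`σ = -1`) edges. -/
def collinearSet (d₁ d₂ σ e : ℝ) : Set RelState :=
  {x | x ∈ relSpace d₁ d₂ ∧ (x.2.2.1 = e ∧ x.2.2.2 = e) ∧ dirVec x.1 = σ • dirVec x.2.1}

theorem Ud_eq_collinearSet (d₁ d₂ : ℝ) : Ud d₁ d₂ = collinearSet d₁ d₂ 1 0 := by
  simp [Ud, collinearSet]

theorem Uu_eq_collinearSet (d₁ d₂ c : ℝ) :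
    Uu d₁ d₂ c = collinearSet d₁ d₂ (-1) (-(2 * c / 3)) := by
  simp [Uu, collinearSet]

/-- The deviation `1 - σ cos θ` of the angle `θ` between the edges from collinearity. -/
noncomputable def misalignment (σ : ℝ) (x : RelState) : ℝ :=
  1 - σ * inner ℝ (dirVec x.1) (dirVec x.2.1)

/-- A Lyapunov function for the set `collinearSet d₁ d₂ σ e`. -/
noncomputable def lyapunov (σ e : ℝ) (x : RelState) : ℝ :=
  (x.2.2.1 - e) ^ 2 + (x.2.2.2 - e) ^ 2 + misalignment σ x

section Distance

variable {d₁ d₂ σ e : ℝ} {x : RelState}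

/-- The misalignment is half a squared chord of the unit circle. It is already of second order in
the distance, which is why it enters `lyapunov` unsquared. -/
theorem norm_dirVec_sub_sq (hσ : σ = 1 ∨ σ = -1) (hx : x ∈ relSpace d₁ d₂) :
    ‖dirVec x.2.1 - σ • dirVec x.1‖ ^ 2 = 2 * misalignment σ x := by
  have hs : |σ| = 1 := by rcases hσ with rfl | rfl <;> simp
  rw [norm_sub_sq_real, norm_smul, norm_dirVec hx.1, norm_dirVec hx.2.1, real_inner_smul_right,
    misalignment, real_inner_comm (dirVec x.1), Real.norm_eq_abs, hs]
  ring

theorem misalignment_nonneg (hσ : σ = 1 ∨ σ = -1) (hx : x ∈ relSpace d₁ d₂) :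
    0 ≤ misalignment σ x := by
  nlinarith [norm_dirVec_sub_sq hσ hx, sq_nonneg ‖dirVec x.2.1 - σ • dirVec x.1‖]

theorem lyapunov_nonneg (hσ : σ = 1 ∨ σ = -1) (hx : x ∈ relSpace d₁ d₂) :
    0 ≤ lyapunov σ e x :=
  add_nonneg (add_nonneg (sq_nonneg _) (sq_nonneg _)) (misalignment_nonneg hσ hx)

theorem mem_collinearSet_of_norm_eq_one (hσ : σ = 1 ∨ σ = -1) (h₁ : 0 < d₁ + e)
    (h₂ : 0 < d₂ + e) {u : Plane} (hu : ‖u‖ = 1) :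
    ((d₁ + e) • u, (d₂ + e) • (σ • u), e, e) ∈ collinearSet d₁ d₂ σ e := by
  have hs : σ * σ = 1 := by rcases hσ with rfl | rfl <;> simp
  have hs' : |σ| = 1 := by rcases hσ with rfl | rfl <;> simp
  have hu0 : u ≠ 0 := norm_ne_zero_iff.1 (by rw [hu]; exact one_ne_zero)
  have hsu : ‖σ • u‖ = 1 := by rw [norm_smul, hu, Real.norm_eq_abs, hs', one_mul]
  have hsu0 : σ • u ≠ 0 := norm_ne_zero_iff.1 (by rw [hsu]; exact one_ne_zero)
  refine ⟨⟨smul_ne_zero h₁.ne' hu0, smul_ne_zero h₂.ne' hsu0, ?_, ?_⟩, ⟨rfl, rfl⟩, ?_⟩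
  · simp only [norm_smul, hu, Real.norm_of_nonneg h₁.le]; ring
  · simp only [norm_smul _ (σ • u), hsu, Real.norm_of_nonneg h₂.le]; ring
  · simp only [dirVec_smul_of_pos h₁ hu, dirVec_smul_of_pos h₂ hsu]
    rw [smul_smul, hs, one_smul]

theorem collinearSet_nonempty (hσ : σ = 1 ∨ σ = -1) (h₁ : 0 < d₁ + e) (h₂ : 0 < d₂ + e) :
    (collinearSet d₁ d₂ σ e).Nonempty :=
  ⟨_, mem_collinearSet_of_norm_eq_one hσ h₁ h₂
    (show ‖(EuclideanSpace.single 0 1 : Plane)‖ = 1 by simp)⟩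

/-- The Lyapunov function bounds the distance to the collinear set. -/
theorem infDist_collinearSet_le (hσ : σ = 1 ∨ σ = -1) (h₁ : 0 < d₁ + e) (h₂ : 0 < d₂ + e)
    (hx : x ∈ relSpace d₁ d₂) :
    Metric.infDist x (collinearSet d₁ d₂ σ e) ≤
      (2 + 2 * (d₂ + e)) * Real.sqrt (lyapunov σ e x) := by
  have hq := misalignment_nonneg hσ hx
  have hV : lyapunov σ e x =
    (x.2.2.1 - e) ^ 2 + (x.2.2.2 - e) ^ 2 + misalignment σ x := rfl
  have hf₁ : |x.2.2.1 - e| ≤ Real.sqrt (lyapunov σ e x) :=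
    Real.abs_le_sqrt (by rw [hV]; nlinarith [sq_nonneg (x.2.2.2 - e)])
  have hf₂ : |x.2.2.2 - e| ≤ Real.sqrt (lyapunov σ e x) :=
    Real.abs_le_sqrt (by rw [hV]; nlinarith [sq_nonneg (x.2.2.1 - e)])
  have hsq := Real.sq_sqrt (lyapunov_nonneg (e := e) hσ hx)
  have hs0 := Real.sqrt_nonneg (lyapunov σ e x)
  have huv : ‖dirVec x.2.1 - σ • dirVec x.1‖ ≤ 2 * Real.sqrt (lyapunov σ e x) := by
    refine abs_le_of_sq_le_sq' ?_ (by positivity) |>.2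
    rw [norm_dirVec_sub_sq hσ hx, mul_pow, hsq, hV]
    nlinarith [sq_nonneg (x.2.2.1 - e), sq_nonneg (x.2.2.2 - e)]
  -- The comparison point keeps `ẑ₁`, turns the second edge onto `σẑ₁` and resets both lengths. The
  -- second edge costs most: its length error plus `d₂ + e` times the chord.
  refine (Metric.infDist_le_dist_of_mem
    (mem_collinearSet_of_norm_eq_one hσ h₁ h₂ (norm_dirVec hx.1))).trans ?_
  have hz₁ : ‖x.1 - (d₁ + e) • dirVec x.1‖ = |x.2.2.1 - e| := by
    have : x.1 - (d₁ + e) • dirVec x.1 = (x.2.2.1 - e) • dirVec x.1 := by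
      rw [hx.2.2.1]
      nth_rewrite 1 [← norm_smul_dirVec hx.1]
      module
    rw [this, norm_smul, norm_dirVec hx.1, mul_one, Real.norm_eq_abs]
  have hz₂ : ‖x.2.1 - (d₂ + e) • (σ • dirVec x.1)‖ ≤
      |x.2.2.2 - e| + (d₂ + e) * ‖dirVec x.2.1 - σ • dirVec x.1‖ := by
    have : x.2.1 - (d₂ + e) • (σ • dirVec x.1) = (x.2.2.2 - e) • dirVec x.2.1 +
        (d₂ + e) • (dirVec x.2.1 - σ • dirVec x.1) := by
      rw [hx.2.2.2]
      nth_rewrite 1 [← norm_smul_dirVec hx.2.1]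
      module
    rw [this]
    refine (norm_add_le _ _).trans_eq ?_
    rw [norm_smul, norm_smul, norm_dirVec hx.2.1, mul_one, Real.norm_eq_abs,
      Real.norm_of_nonneg h₂.le]
  have hmul : 0 ≤ (d₂ + e) * Real.sqrt (lyapunov σ e x) := by positivity
  rw [Prod.dist_eq, Prod.dist_eq, Prod.dist_eq]
  simp only [dist_eq_norm, Real.norm_eq_abs]
  refine max_le ?_ (max_le ?_ (max_le ?_ ?_))
  · rw [hz₁]; nlinarith
  · nlinarith [mul_le_mul_of_nonneg_left huv h₂.le]
  · nlinarith
  · nlinarith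

/-- The factor `2` counts the displacement twice: once directly and once for the change of length.
-/
theorem norm_dirVec_sub_dirVec_le {z w : Plane} (hz : z ≠ 0) (hw : w ≠ 0) :
    ‖dirVec z - dirVec w‖ ≤ 2 / ‖w‖ * ‖z - w‖ := by
  have hw' := norm_pos_iff.2 hw
  have h : ‖w‖ • (dirVec z - dirVec w) = (‖w‖ - ‖z‖) • dirVec z + (z - w) := by
    have hzw : z - w = ‖z‖ • dirVec z - ‖w‖ • dirVec w := by
      rw [norm_smul_dirVec hz, norm_smul_dirVec hw]
    rw [hzw]
    module
  have h2 : ‖w‖ * ‖dirVec z - dirVec w‖ ≤ 2 * ‖z - w‖ := by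
    calc ‖w‖ * ‖dirVec z - dirVec w‖ = ‖‖w‖ • (dirVec z - dirVec w)‖ := by
          rw [norm_smul, norm_norm]
      _ ≤ ‖(‖w‖ - ‖z‖) • dirVec z‖ + ‖z - w‖ := by rw [h]; exact norm_add_le _ _
      _ = |‖w‖ - ‖z‖| + ‖z - w‖ := by
          rw [norm_smul, norm_dirVec hz, mul_one, Real.norm_eq_abs]
      _ ≤ ‖z - w‖ + ‖z - w‖ := by
          gcongr
          rw [norm_sub_rev]
          exact abs_norm_sub_norm_le w z
      _ = 2 * ‖z - w‖ := by ring
  rw [div_mul_eq_mul_div, le_div_iff₀ hw']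
  linarith

theorem abs_error_le_infDist (hA : (collinearSet d₁ d₂ σ e).Nonempty) (x : RelState) :
    |x.2.2.1 - e| ≤ Metric.infDist x (collinearSet d₁ d₂ σ e) ∧
      |x.2.2.2 - e| ≤ Metric.infDist x (collinearSet d₁ d₂ σ e) := by
  constructor <;> refine (Metric.le_infDist hA).2 fun a ha => ?_ <;>
    obtain ⟨-, ⟨ha₁, ha₂⟩, -⟩ := ha
  · rw [← ha₁, ← Real.dist_eq, Prod.dist_eq, Prod.dist_eq, Prod.dist_eq]
    simp
  · rw [← ha₂, ← Real.dist_eq, Prod.dist_eq, Prod.dist_eq, Prod.dist_eq]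
    simp

/-- At a point of the collinear set the chord vanishes, so the chord at `x` is at most the sum of
the changes of the two directions, and each direction is Lipschitz. -/
theorem sqrt_misalignment_le_infDist (hσ : σ = 1 ∨ σ = -1) (h₁ : 0 < d₁ + e) (h₂ : 0 < d₂ + e)
    (hx : x ∈ relSpace d₁ d₂) :
    Real.sqrt (misalignment σ x) ≤
      (2 / (d₁ + e) + 2 / (d₂ + e)) * Metric.infDist x (collinearSet d₁ d₂ σ e) := by
  have hC : 0 < 2 / (d₁ + e) + 2 / (d₂ + e) := by positivity
  rw [mul_comm, ← div_le_iff₀ hC, Metric.le_infDist (collinearSet_nonempty hσ h₁ h₂)]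
  intro a ha
  rw [div_le_iff₀ hC]
  obtain ⟨⟨ha₁, ha₂, hn₁, hn₂⟩, ⟨he₁, he₂⟩, hu⟩ := ha
  have hs : σ * σ = 1 := by rcases hσ with rfl | rfl <;> simp
  have hs' : |σ| = 1 := by rcases hσ with rfl | rfl <;> simp
  have hl₁ : ‖a.1‖ = d₁ + e := by linarith
  have hl₂ : ‖a.2.1‖ = d₂ + e := by linarith
  have hd₁ : ‖x.1 - a.1‖ ≤ dist x a := by
    rw [← dist_eq_norm, Prod.dist_eq]; exact le_max_left _ _
  have hd₂ : ‖x.2.1 - a.2.1‖ ≤ dist x a := by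
    rw [← dist_eq_norm, Prod.dist_eq, Prod.dist_eq]
    exact (le_max_left _ _).trans (le_max_right _ _)
  have hsplit : dirVec x.2.1 - σ • dirVec x.1 =
      (dirVec x.2.1 - dirVec a.2.1) - σ • (dirVec x.1 - dirVec a.1) := by
    rw [hu, smul_sub, smul_smul, hs, one_smul]; abel
  have hq := misalignment_nonneg hσ hx
  calc Real.sqrt (misalignment σ x) ≤ ‖dirVec x.2.1 - σ • dirVec x.1‖ := by
        refine Real.sqrt_le_iff.2 ⟨norm_nonneg _, ?_⟩
        rw [norm_dirVec_sub_sq hσ hx]; linarith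
    _ ≤ ‖dirVec x.2.1 - dirVec a.2.1‖ + ‖dirVec x.1 - dirVec a.1‖ := by
        rw [hsplit]
        refine (norm_sub_le _ _).trans_eq ?_
        rw [norm_smul, Real.norm_eq_abs, hs', one_mul]
    _ ≤ 2 / (d₂ + e) * dist x a + 2 / (d₁ + e) * dist x a := by
        refine add_le_add ?_ ?_
        · refine (norm_dirVec_sub_dirVec_le hx.2.1 ha₂).trans ?_
          rw [hl₂]; gcongr
        · refine (norm_dirVec_sub_dirVec_le hx.1 ha₁).trans ?_
          rw [hl₁]; gcongr
    _ = dist x a * (2 / (d₁ + e) + 2 / (d₂ + e)) := by ring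

/-- The distance to the collinear set bounds the Lyapunov function. -/
theorem sqrt_lyapunov_le_infDist (hσ : σ = 1 ∨ σ = -1) (h₁ : 0 < d₁ + e) (h₂ : 0 < d₂ + e)
    (hx : x ∈ relSpace d₁ d₂) :
    Real.sqrt (lyapunov σ e x) ≤
      (2 + (2 / (d₁ + e) + 2 / (d₂ + e))) * Metric.infDist x (collinearSet d₁ d₂ σ e) := by
  obtain ⟨hf₁, hf₂⟩ := abs_error_le_infDist (collinearSet_nonempty hσ h₁ h₂) x
  have hq := sqrt_misalignment_le_infDist hσ h₁ h₂ hx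
  have hsum : Real.sqrt (lyapunov σ e x) ≤
      |x.2.2.1 - e| + |x.2.2.2 - e| + Real.sqrt (misalignment σ x) := by
    refine Real.sqrt_le_iff.2 ⟨by positivity, ?_⟩
    rw [lyapunov]
    nlinarith [Real.sq_sqrt (misalignment_nonneg hσ hx), Real.sqrt_nonneg (misalignment σ x),
      sq_abs (x.2.2.1 - e), sq_abs (x.2.2.2 - e), abs_nonneg (x.2.2.1 - e),
      abs_nonneg (x.2.2.2 - e),
      mul_nonneg (abs_nonneg (x.2.2.1 - e)) (abs_nonneg (x.2.2.2 - e)),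
      mul_nonneg (abs_nonneg (x.2.2.1 - e)) (Real.sqrt_nonneg (misalignment σ x)),
      mul_nonneg (abs_nonneg (x.2.2.2 - e)) (Real.sqrt_nonneg (misalignment σ x))]
  linarith

/-- Arbitrarily close to the collinear set there are states that are not collinear. -/
theorem exists_misalignment_pos_infDist_lt (hσ : σ = 1 ∨ σ = -1) (h₁ : 0 < d₁ + e)
    (h₂ : 0 < d₂ + e) {δ : ℝ} (hδ : 0 < δ) :
    ∃ x ∈ relSpace d₁ d₂, 0 < misalignment σ x ∧
      Metric.infDist x (collinearSet d₁ d₂ σ e) < δ := by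
  have hs : σ * σ = 1 := by rcases hσ with rfl | rfl <;> simp
  have hs' : |σ| = 1 := by rcases hσ with rfl | rfl <;> simp
  set C := 2 + 2 * (d₂ + e) with hC
  have hC0 : 0 < C := by positivity
  -- `τ` will be the misalignment of a state with errors exactly `e`, whence `V = τ`. The choice
  -- gives `C√τ ≤ δ/2`, and `τ ≤ 1` keeps `1 - (1 - τ)²` nonnegative.
  set τ := min 1 ((δ / (2 * C)) ^ 2) with hτ
  have hτ0 : 0 < τ := lt_min one_pos (by positivity)
  have hτ1 : τ ≤ 1 := min_le_left _ _
  have hb := Real.sq_sqrt (show 0 ≤ 1 - (1 - τ) ^ 2 by nlinarith)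
  set b := Real.sqrt (1 - (1 - τ) ^ 2)
  let u : Plane := !₂[1, 0]
  let v : Plane := !₂[1 - τ, b]
  have hu : ‖u‖ = 1 := by simp [u, EuclideanSpace.norm_eq]
  have hv : ‖v‖ = 1 := by simp [v, EuclideanSpace.norm_eq, hb]
  have huv : inner ℝ u v = 1 - τ := by simp [u, v, PiLp.inner_apply]
  have hsv : ‖σ • v‖ = 1 := by rw [norm_smul, hv, Real.norm_eq_abs, hs', one_mul]
  let x : RelState := ((d₁ + e) • u, (d₂ + e) • (σ • v), e, e)
  have hxM : x ∈ relSpace d₁ d₂ := by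
    refine ⟨smul_ne_zero h₁.ne' (norm_ne_zero_iff.1 (by rw [hu]; exact one_ne_zero)),
      smul_ne_zero h₂.ne' (norm_ne_zero_iff.1 (by rw [hsv]; exact one_ne_zero)), ?_, ?_⟩
    · simp only [x, norm_smul, hu, Real.norm_of_nonneg h₁.le]; ring
    · simp only [x, norm_smul _ (σ • v), hsv, Real.norm_of_nonneg h₂.le]; ring
  have hq : misalignment σ x = τ := by
    simp only [misalignment, x, dirVec_smul_of_pos h₁ hu, dirVec_smul_of_pos h₂ hsv,
      real_inner_smul_right, huv, ← mul_assoc, hs]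
    ring
  refine ⟨x, hxM, hq ▸ hτ0, (infDist_collinearSet_le hσ h₁ h₂ hxM).trans_lt ?_⟩
  have hV : lyapunov σ e x = τ := by simp [lyapunov, hq, x]
  have hsq : Real.sqrt τ ≤ δ / (2 * C) :=
    Real.sqrt_le_iff.2 ⟨by positivity, min_le_right _ _⟩
  rw [hV, ← hC]
  calc C * Real.sqrt τ ≤ C * (δ / (2 * C)) := by gcongr
    _ = δ / 2 := by field_simp
    _ < δ := by linarith

end Distance

end FlexibleFormation

namespace FlexibleFormation

/-! ### Global solutions of the closed loop -/

/-- The closed loop as a vector field for the relative positions alone. -/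
noncomputable def planeField (d₁ d₂ c : ℝ) (z : Plane × Plane) : Plane × Plane :=
  ((closedLoopRHS c z.1 z.2 (‖z.1‖ - d₁) (‖z.2‖ - d₂)).1,
    (closedLoopRHS c z.1 z.2 (‖z.1‖ - d₁) (‖z.2‖ - d₂)).2.1)

theorem isOpen_ne_zero_prod : IsOpen {z : Plane × Plane | z.1 ≠ 0 ∧ z.2 ≠ 0} :=
  (isOpen_ne_fun continuous_fst continuous_const).inter
    (isOpen_ne_fun continuous_snd continuous_const)

theorem contDiffOn_planeField (d₁ d₂ c : ℝ) :
    ContDiffOn ℝ 1 (planeField d₁ d₂ c) {z | z.1 ≠ 0 ∧ z.2 ≠ 0} := by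
  have h₁ : ContDiffOn ℝ 1 (fun z : Plane × Plane => z.1) {z | z.1 ≠ 0 ∧ z.2 ≠ 0} :=
    contDiff_fst.contDiffOn
  have h₂ : ContDiffOn ℝ 1 (fun z : Plane × Plane => z.2) {z | z.1 ≠ 0 ∧ z.2 ≠ 0} :=
    contDiff_snd.contDiffOn
  have n₁ := h₁.norm ℝ fun z hz => hz.1
  have n₂ := h₂.norm ℝ fun z hz => hz.2
  have u₁ := (n₁.inv fun z hz => norm_ne_zero_iff.2 hz.1).smul h₁
  have u₂ := (n₂.inv fun z hz => norm_ne_zero_iff.2 hz.2).smul h₂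
  have e₁ := n₁.sub (contDiffOn_const (c := d₁))
  have e₂ := n₂.sub (contDiffOn_const (c := d₂))
  have c₀ : ContDiffOn ℝ 1 (fun _ : Plane × Plane => c) {z | z.1 ≠ 0 ∧ z.2 ≠ 0} :=
    contDiffOn_const
  have c₂ : ContDiffOn ℝ 1 (fun _ : Plane × Plane => (2 : ℝ)) {z | z.1 ≠ 0 ∧ z.2 ≠ 0} :=
    contDiffOn_const
  exact ((((((c₂.mul e₁).neg).smul u₁).add (e₂.smul u₂)).sub (c₀.smul u₁)).add
    (c₀.smul u₂)).prodMk (((((c₂.mul e₂).neg.smul u₂).add (e₁.smul u₁)).add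
    (c₀.smul u₁)).sub (c₀.smul u₂))

/-- `relSpace` is a graph over the open set of nonzero pairs but is not open itself, so existence is
proved for the relative positions and lifted back. -/
theorem isSolutionOn_of_planeField {d₁ d₂ c : ℝ} {I : Set ℝ} {S : Set (Plane × Plane)}
    (hS : S ⊆ {z | z.1 ≠ 0 ∧ z.2 ≠ 0}) {z : ℝ → Plane × Plane}
    (hz : IsSolutionOn S (planeField d₁ d₂ c) I z) :
    IsSolutionOn (relSpace d₁ d₂) (closedLoopField c) I
      (fun t => ((z t).1, (z t).2, ‖(z t).1‖ - d₁, ‖(z t).2‖ - d₂)) := by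
  intro t ht
  obtain ⟨hzS, hd⟩ := hz t ht
  exact ⟨⟨(hS hzS).1, (hS hzS).2, rfl, rfl⟩, hasDerivWithinAt_closedLoop (hS hzS).1 (hS hzS).2
    (hasDerivWithinAt_prod_fst hd) (hasDerivWithinAt_prod_snd hd)⟩

/-- If the errors of the solutions from `x₀` cannot reach the boundary of `[e - ρ, e + ρ]`, then
there is such a solution on `[0, ∞)`. -/
theorem exists_isSolutionOn_closedLoop {d₁ d₂ c e ρ : ℝ} (hρ₁ : ρ < d₁ + e) (hρ₂ : ρ < d₂ + e)
    {x₀ : RelState} (hx₀ : x₀ ∈ relSpace d₁ d₂) (h₁ : |x₀.2.2.1 - e| ≤ ρ)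
    (h₂ : |x₀.2.2.2 - e| ≤ ρ)
    (htrap : ∀ T ≥ 0, ∀ x : ℝ → RelState, x 0 = x₀ →
      IsSolutionOn (relSpace d₁ d₂) (closedLoopField c) (Icc 0 T) x →
      (∀ t ∈ Icc 0 T, |(x t).2.2.1 - e| ≤ ρ ∧ |(x t).2.2.2 - e| ≤ ρ) →
      |(x T).2.2.1 - e| < ρ ∧ |(x T).2.2.2 - e| < ρ) :
    ∃ x : ℝ → RelState, x 0 = x₀ ∧
      IsSolutionOn (relSpace d₁ d₂) (closedLoopField c) (Ici 0) x ∧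
      ∀ t ∈ Ici (0 : ℝ), |(x t).2.2.1 - e| ≤ ρ ∧ |(x t).2.2.2 - e| ≤ ρ := by
  -- A product of closed annuli: compact, and away from zero edges because `ρ < dₖ + e`.
  set K : Set (Plane × Plane) := {z | |‖z.1‖ - d₁ - e| ≤ ρ ∧ |‖z.2‖ - d₂ - e| ≤ ρ} with hKdef
  have hKU : K ⊆ {z | z.1 ≠ 0 ∧ z.2 ≠ 0} := by
    intro z hz
    constructor <;> intro h0
    · have := (abs_le.1 hz.1).1
      rw [h0, norm_zero] at this
      linarith
    · have := (abs_le.1 hz.2).1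
      rw [h0, norm_zero] at this
      linarith
  have hcont₁ : Continuous fun z : Plane × Plane => |‖z.1‖ - d₁ - e| := by fun_prop
  have hcont₂ : Continuous fun z : Plane × Plane => |‖z.2‖ - d₂ - e| := by fun_prop
  have hK : IsCompact K := by
    refine Metric.isCompact_of_isClosed_isBounded ?_ ?_
    · exact (isClosed_le hcont₁ continuous_const).inter
        (isClosed_le hcont₂ continuous_const)
    · refine (((Metric.isBounded_closedBall (x := (0 : Plane)) (r := d₁ + e + ρ)).prod
        (Metric.isBounded_closedBall (x := (0 : Plane)) (r := d₂ + e + ρ)))).subset fun z hz => ?_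
      rw [mem_prod, mem_closedBall_zero_iff, mem_closedBall_zero_iff]
      exact ⟨by linarith [(abs_le.1 hz.1).2], by linarith [(abs_le.1 hz.2).2]⟩
  have hint : {z : Plane × Plane | |‖z.1‖ - d₁ - e| < ρ ∧ |‖z.2‖ - d₂ - e| < ρ} ⊆
      interior K := by
    refine interior_maximal (fun z hz => ⟨hz.1.le, hz.2.le⟩) ?_
    exact (isOpen_lt hcont₁ continuous_const).inter
        (isOpen_lt hcont₂ continuous_const)
  obtain ⟨hz₁, hz₂, he₁, he₂⟩ := hx₀
  have hx₀' : x₀ = (x₀.1, x₀.2.1, ‖x₀.1‖ - d₁, ‖x₀.2.1‖ - d₂) := by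
    rw [← he₁, ← he₂]
  obtain ⟨z, hz0, hz⟩ := exists_isSolutionOn_Ici_of_trapped isOpen_ne_zero_prod hK hKU
    (contDiffOn_planeField d₁ d₂ c) (x₀ := (x₀.1, x₀.2.1))
    ⟨by rw [← he₁]; exact h₁, by rw [← he₂]; exact h₂⟩ (by
      intro T hT z hz0 hz
      exact hint (htrap T hT _ (by simp only [hz0]; exact hx₀'.symm)
        (isSolutionOn_of_planeField hKU hz) fun t ht => (hz t ht).1))
  exact ⟨_, by simp only [hz0]; exact hx₀'.symm, isSolutionOn_of_planeField hKU hz,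
    fun t ht => (hz t ht).1⟩

/-! ### Evolution of the errors and of the misalignment -/

section Evolution

variable {d₁ d₂ c σ e : ℝ} {I : Set ℝ} {x : ℝ → RelState}

/-- As `σ² = 1`, the factor `1 - s²` becomes `q(2 - q)`; the sign of `σ(e + c)` then decides whether
`q` shrinks or grows. -/
theorem hasDerivWithinAt_misalignment (hσ : σ = 1 ∨ σ = -1)
    (hx : IsSolutionOn (relSpace d₁ d₂) (closedLoopField c) I x) {t : ℝ} (ht : t ∈ I) :
    HasDerivWithinAt (fun s => misalignment σ (x s))
      (-(misalignment σ (x t) * (2 - misalignment σ (x t)) *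
        (σ * ((x t).2.2.2 - e + (e + c)) / ‖(x t).1‖ +
          σ * ((x t).2.2.1 - e + (e + c)) / ‖(x t).2.1‖))) I t := by
  refine (((hasDerivWithinAt_cos hx ht).const_mul σ).const_sub 1).congr_deriv ?_
  simp only [misalignment]
  rcases hσ with rfl | rfl <;> ring

/-- The condition `he` says that `e` is the equilibrium error at cosine `σ`. It removes the constant
term and leaves a linear part plus a remainder proportional to `q`. -/
theorem hasDerivWithinAt_errors (hσ : σ = 1 ∨ σ = -1) (he : -2 * e - c + σ * (e + c) = 0)
    (hx : IsSolutionOn (relSpace d₁ d₂) (closedLoopField c) I x) {t : ℝ} (ht : t ∈ I) :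
    HasDerivWithinAt (fun s => (x s).2.2.1 - e)
      (-2 * ((x t).2.2.1 - e) + σ * ((x t).2.2.2 - e) -
        misalignment σ (x t) * (σ * ((x t).2.2.2 - e + (e + c)))) I t ∧
    HasDerivWithinAt (fun s => (x s).2.2.2 - e)
      (-2 * ((x t).2.2.2 - e) + σ * ((x t).2.2.1 - e) -
        misalignment σ (x t) * (σ * ((x t).2.2.1 - e + (e + c)))) I t := by
  have hs : σ * σ = 1 := by rcases hσ with rfl | rfl <;> simp
  obtain ⟨-, hd⟩ := hx t ht
  have h := hasDerivWithinAt_prod_snd (hasDerivWithinAt_prod_snd hd)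
  constructor
  · refine ((hasDerivWithinAt_prod_fst h).sub_const e).congr_deriv ?_
    simp only [closedLoopField, closedLoopRHS, misalignment]
    linear_combination he - inner ℝ (dirVec (x t).1) (dirVec (x t).2.1) * ((x t).2.2.2 + c) * hs
  · refine ((hasDerivWithinAt_prod_snd h).sub_const e).congr_deriv ?_
    simp only [closedLoopField, closedLoopRHS, misalignment,
      real_inner_comm (dirVec (x t).1) (dirVec (x t).2.1)]
    linear_combination he - inner ℝ (dirVec (x t).1) (dirVec (x t).2.1) * ((x t).2.2.1 + c) * hs

/-- The turning rate stays away from zero near a collinear set. -/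
theorem le_turning_rate {k g₁ g₂ l₁ l₂ L₁ L₂ : ℝ} (hk : 0 < k) (hg₁ : k / 2 ≤ g₁)
    (hg₂ : k / 2 ≤ g₂) (h₁ : 0 < l₁) (h₂ : 0 < l₂) (hl₁ : l₁ ≤ 2 * L₁) (hl₂ : l₂ ≤ 2 * L₂) :
    k / 4 * (1 / L₁ + 1 / L₂) ≤ g₂ / l₁ + g₁ / l₂ := by
  have hL₁ : 0 < L₁ := by linarith
  have hL₂ : 0 < L₂ := by linarith
  calc k / 4 * (1 / L₁ + 1 / L₂) = (k / 2) / (2 * L₁) + (k / 2) / (2 * L₂) := by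
        field_simp; ring
    _ ≤ g₂ / l₁ + g₁ / l₂ := by
        refine add_le_add ?_ ?_
        · exact div_le_div₀ (by linarith) hg₂ h₁ hl₁
        · exact div_le_div₀ (by linarith) hg₁ h₂ hl₂

/-- Dissipation of the Lyapunov function. -/
theorem dissipation {k m ρ σ f₁ f₂ q κ S : ℝ} (hσ : σ = 1 ∨ σ = -1) (hκ : σ * κ = k)
    (hk : 0 < k) (hm : 0 < m) (hρk : ρ ≤ k / 2) (hρm : 12 * k * ρ ≤ m)
    (hf₁ : |f₁| ≤ ρ) (hf₂ : |f₂| ≤ ρ) (hq0 : 0 ≤ q) (hq1 : q ≤ 1) (hS : m ≤ S) :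
    2 * f₁ * (-2 * f₁ + σ * f₂ - q * (σ * (f₂ + κ))) +
      2 * f₂ * (-2 * f₂ + σ * f₁ - q * (σ * (f₁ + κ))) + -(q * (2 - q) * S) ≤
      -(min 2 (m / 2)) * (f₁ ^ 2 + f₂ ^ 2 + q) := by
  have hρ0 : 0 ≤ ρ := (abs_nonneg _).trans hf₁
  have hσa : |σ| = 1 := by rcases hσ with rfl | rfl <;> simp
  have hturn : q * m ≤ q * (2 - q) * S := by
    nlinarith [mul_nonneg hq0 (sub_nonneg.2 hq1), mul_le_mul_of_nonneg_left hS hq0,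
      mul_nonneg (mul_nonneg hq0 (sub_nonneg.2 hq1)) (hm.le.trans hS)]
  have hf12 : |σ * (f₁ * f₂)| ≤ ρ * (k / 2) := by
    rw [abs_mul, hσa, one_mul, abs_mul]
    exact mul_le_mul hf₁ (hf₂.trans hρk) (abs_nonneg _) hρ0
  have hprod : 2 * (σ * (f₁ * f₂)) ≤ f₁ ^ 2 + f₂ ^ 2 := by
    rcases hσ with rfl | rfl <;> nlinarith [sq_nonneg (f₁ - f₂), sq_nonneg (f₁ + f₂)]
  -- The product term contributes at most `2kρ` and the linear terms `4kρ`. Since `12kρ ≤ m`, the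
  -- total `6kρq` uses up at most half of the decay `mq`.
  have hcross : -(q * (4 * (σ * (f₁ * f₂)) + 2 * k * (f₁ + f₂))) ≤ q * (6 * k * ρ) := by
    rw [← mul_neg]
    refine mul_le_mul_of_nonneg_left ?_ hq0
    nlinarith [(abs_le.1 hf12).1, (abs_le.1 hf₁).1, (abs_le.1 hf₂).1]
  have hmin₁ : min 2 (m / 2) * (f₁ ^ 2 + f₂ ^ 2) ≤ 2 * (f₁ ^ 2 + f₂ ^ 2) := by
    gcongr; exact min_le_left _ _
  have hmin₂ : min 2 (m / 2) * q ≤ m / 2 * q := by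
    gcongr; exact min_le_right _ _
  have hρq : q * (6 * k * ρ) ≤ q * (m / 2) := by
    refine mul_le_mul_of_nonneg_left ?_ hq0
    linarith
  have hexp : 2 * f₁ * (-2 * f₁ + σ * f₂ - q * (σ * (f₂ + κ))) +
      2 * f₂ * (-2 * f₂ + σ * f₁ - q * (σ * (f₁ + κ))) =
      -4 * (f₁ ^ 2 + f₂ ^ 2) + 2 * (2 * (σ * (f₁ * f₂))) -
        q * (4 * (σ * (f₁ * f₂)) + 2 * k * (f₁ + f₂)) := by
    rw [← hκ]; ring
  rw [hexp]
  nlinarith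

end Evolution

/-! ### Stability and instability of the collinear sets -/

section StabilityOfCollinearSets

variable {d₁ d₂ c σ e : ℝ}

/-- The edge lengths and the driving terms of the angle near the collinear set. -/
theorem turning_rate_bounds {k ρ : ℝ} {s : ℝ} {x : RelState} (hs : s = 1 ∨ s = -1)
    (hκ : s * (e + c) = k) (hk : 0 < k) (hρk : ρ ≤ k / 2) (hρ₁ : ρ < d₁ + e) (hρ₂ : ρ < d₂ + e)
    (hx : x ∈ relSpace d₁ d₂) (hf₁ : |x.2.2.1 - e| ≤ ρ) (hf₂ : |x.2.2.2 - e| ≤ ρ) :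
    k / 4 * (1 / (d₁ + e) + 1 / (d₂ + e)) ≤
      s * (x.2.2.2 - e + (e + c)) / ‖x.1‖ + s * (x.2.2.1 - e + (e + c)) / ‖x.2.1‖ := by
  obtain ⟨hz₁, hz₂, he₁, he₂⟩ := hx
  obtain ⟨a₁, b₁⟩ := abs_le.1 hf₁
  obtain ⟨a₂, b₂⟩ := abs_le.1 hf₂
  -- Each driving term is at least `k - ρ ≥ k/2`, and each length is at most `dₖ + e + ρ ≤ 2(dₖ +
  -- e)`.
  refine le_turning_rate hk ?_ ?_ (norm_pos_iff.2 hz₁) (norm_pos_iff.2 hz₂)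
    (by linarith) (by linarith)
  · rw [mul_add, hκ]
    rcases hs with rfl | rfl <;> linarith
  · rw [mul_add, hκ]
    rcases hs with rfl | rfl <;> linarith

theorem isLocallyExpStableSet_collinearSet (hσ : σ = 1 ∨ σ = -1) (h₁ : 0 < d₁ + e)
    (h₂ : 0 < d₂ + e) (he : -2 * e - c + σ * (e + c) = 0) (hk : 0 < σ * (e + c)) :
    IsLocallyExpStableSet (relSpace d₁ d₂) (closedLoopField c) (collinearSet d₁ d₂ σ e) := by
  set k := σ * (e + c) with hkdef
  set m := k / 4 * (1 / (d₁ + e) + 1 / (d₂ + e)) with hmdef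
  have hm : 0 < m := by positivity
  obtain ⟨ρ, hρ0, hρ1, hρk, hρm, hρ₁, hρ₂⟩ : ∃ ρ : ℝ, 0 < ρ ∧ ρ ≤ 1 ∧ ρ ≤ k / 2 ∧
      12 * k * ρ ≤ m ∧ ρ < d₁ + e ∧ ρ < d₂ + e := by
    refine ⟨min (min 1 (min (k / 2) (m / (12 * k)))) (min ((d₁ + e) / 2) ((d₂ + e) / 2)),
      by positivity, ?_, ?_, ?_, ?_, ?_⟩
    · exact (min_le_left _ _).trans (min_le_left _ _)
    · exact (min_le_left _ _).trans ((min_le_right _ _).trans (min_le_left _ _))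
    · rw [mul_comm, ← le_div_iff₀ (by positivity)]
      exact (min_le_left _ _).trans ((min_le_right _ _).trans (min_le_right _ _))
    · exact ((min_le_right _ _).trans (min_le_left _ _)).trans_lt (by linarith)
    · exact ((min_le_right _ _).trans (min_le_right _ _)).trans_lt (by linarith)
  set r := min 2 (m / 2) with hr
  have hr0 : 0 < r := by positivity
  -- below the level `ρ ^ 2` the errors are small
  have hsmall : ∀ y ∈ relSpace d₁ d₂, lyapunov σ e y < ρ ^ 2 →
      |y.2.2.1 - e| < ρ ∧ |y.2.2.2 - e| < ρ ∧ misalignment σ y ≤ 1 := by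
    intro y hy hV
    have hq := misalignment_nonneg hσ hy
    rw [lyapunov] at hV
    refine ⟨abs_lt_of_sq_lt_sq ?_ hρ0.le, abs_lt_of_sq_lt_sq ?_ hρ0.le, ?_⟩
    · nlinarith [sq_nonneg (y.2.2.2 - e)]
    · nlinarith [sq_nonneg (y.2.2.1 - e)]
    · nlinarith [sq_nonneg (y.2.2.1 - e), sq_nonneg (y.2.2.2 - e)]
  have hdecay : ∀ T ≥ 0, ∀ x : ℝ → RelState,
      IsSolutionOn (relSpace d₁ d₂) (closedLoopField c) (Icc 0 T) x →
      lyapunov σ e (x 0) < ρ ^ 2 → ∀ t ∈ Icc 0 T, lyapunov σ e (x t) < ρ ^ 2 ∧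
        lyapunov σ e (x t) ≤ lyapunov σ e (x 0) * Real.exp (-r * t) := by
    intro T hT x hx h0 t ht
    refine le_mul_exp_of_deriv_le_below (φ := fun s => lyapunov σ e (x s)) hr0 (fun s hs =>
      ((((hasDerivWithinAt_errors hσ he hx hs).1.pow 2).add
        ((hasDerivWithinAt_errors hσ he hx hs).2.pow 2)).add
        (hasDerivWithinAt_misalignment (e := e) hσ hx hs))) (fun s hs hV => ?_)
      (lyapunov_nonneg hσ (hx 0 ⟨le_rfl, hT⟩).1) h0 ht
    have hM := (hx s hs).1
    obtain ⟨hf₁, hf₂, hq⟩ := hsmall _ hM hV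
    have hdis := dissipation hσ hkdef.symm hk hm hρk hρm hf₁.le hf₂.le
      (misalignment_nonneg hσ hM) hq
      (turning_rate_bounds hσ hkdef.symm hk hρk hρ₁ hρ₂ hM hf₁.le hf₂.le)
    simpa [lyapunov] using hdis
  set C₁ := 2 + (2 / (d₁ + e) + 2 / (d₂ + e)) with hC₁
  set C₂ := 2 + 2 * (d₂ + e) with hC₂
  have hC₁0 : 0 < C₁ := by positivity
  have hC₂0 : 0 < C₂ := by positivity
  -- The radius `ρ / C₁` forces `√V < ρ` initially. The rate is halved because the distance is
  -- comparable to `√V`, not to `V`.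
  refine ⟨collinearSet_nonempty hσ h₁ h₂, ρ / C₁, by positivity, C₂ * C₁, by positivity, r / 2,
    by positivity, fun x₀ hx₀ hdist => ?_⟩
  have hsqrt := sqrt_lyapunov_le_infDist hσ h₁ h₂ hx₀
  rw [← hC₁] at hsqrt
  have hV0 : lyapunov σ e x₀ < ρ ^ 2 := by
    rw [← Real.sqrt_lt' hρ0]
    rw [lt_div_iff₀ hC₁0] at hdist
    linarith
  obtain ⟨hf₁, hf₂, -⟩ := hsmall x₀ hx₀ hV0
  constructor
  · obtain ⟨x, hx0, hx, -⟩ := exists_isSolutionOn_closedLoop (c := c) hρ₁ hρ₂ hx₀ hf₁.le hf₂.le (by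
      intro T hT x hx0 hx _
      have hTm : T ∈ Icc 0 T := ⟨hT, le_rfl⟩
      have := hsmall _ (hx T hTm).1 (hdecay T hT x hx (by rw [hx0]; exact hV0) T hTm).1
      exact ⟨this.1, this.2.1⟩)
    exact ⟨x, hx0, hx⟩
  · intro T hT x hx0 hx t ht
    have hd := (hdecay T hT x hx (by rw [hx0]; exact hV0) t ht).2
    rw [hx0] at hd
    have hexp : Real.exp (-r * t) = Real.exp (-(r / 2) * t) ^ 2 := by
      rw [← Real.exp_nat_mul]; congr 1; push_cast; ring
    calc Metric.infDist (x t) (collinearSet d₁ d₂ σ e)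
        ≤ C₂ * Real.sqrt (lyapunov σ e (x t)) := infDist_collinearSet_le hσ h₁ h₂ (hx t ht).1
      _ ≤ C₂ * Real.sqrt (lyapunov σ e x₀ * Real.exp (-(r / 2) * t) ^ 2) := by
          rw [← hexp]; gcongr
      _ = C₂ * (Real.sqrt (lyapunov σ e x₀) * Real.exp (-(r / 2) * t)) := by
          rw [Real.sqrt_mul (lyapunov_nonneg hσ hx₀), Real.sqrt_sq (Real.exp_pos _).le]
      _ ≤ C₂ * (C₁ * Metric.infDist x₀ (collinearSet d₁ d₂ σ e) *
            Real.exp (-(r / 2) * t)) := by gcongr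
      _ = C₂ * C₁ * Real.exp (-(r / 2) * t) *
            Metric.infDist x₀ (collinearSet d₁ d₂ σ e) := by ring

/-- Stability would confine the errors, hence yield a global solution from a nearby non-collinear
state; along it `q' ≥ mq`, which is incompatible with `q ≤ 1`. -/
theorem isUnstableSet_collinearSet (hσ : σ = 1 ∨ σ = -1) (h₁ : 0 < d₁ + e)
    (h₂ : 0 < d₂ + e) (hk : σ * (e + c) < 0) :
    IsUnstableSet (relSpace d₁ d₂) (closedLoopField c) (collinearSet d₁ d₂ σ e) := by
  intro hstable
  -- The reversed sign `-σ` makes the driving constant positive, so that `turning_rate_bounds` now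
  -- bounds the growth rate.
  obtain ⟨k, hkdef⟩ : ∃ k, -σ * (e + c) = k := ⟨_, rfl⟩
  have hk0 : 0 < k := by rw [← hkdef]; linarith
  have hσ' : -σ = 1 ∨ -σ = -1 := by rcases hσ with rfl | rfl <;> simp
  set m := k / 4 * (1 / (d₁ + e) + 1 / (d₂ + e)) with hmdef
  have hm : 0 < m := by positivity
  obtain ⟨ρ, hρ0, hρk, hρ₁, hρ₂⟩ : ∃ ρ : ℝ, 0 < ρ ∧ ρ ≤ k / 2 ∧ ρ < d₁ + e ∧ ρ < d₂ + e := by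
    refine ⟨min (k / 2) (min ((d₁ + e) / 2) ((d₂ + e) / 2)), by positivity, min_le_left _ _, ?_, ?_⟩
    · exact ((min_le_right _ _).trans (min_le_left _ _)).trans_lt (by linarith)
    · exact ((min_le_right _ _).trans (min_le_right _ _)).trans_lt (by linarith)
  set C := 2 / (d₁ + e) + 2 / (d₂ + e) with hC
  have hC0 : 0 < C := by positivity
  have hA := collinearSet_nonempty hσ h₁ h₂
  have hnear : ∀ y ∈ relSpace d₁ d₂,
      Metric.infDist y (collinearSet d₁ d₂ σ e) < min ρ (1 / C) →
      (|y.2.2.1 - e| < ρ ∧ |y.2.2.2 - e| < ρ) ∧ misalignment σ y ≤ 1 := by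
    intro y hy hdist
    obtain ⟨hf₁, hf₂⟩ := abs_error_le_infDist hA y
    have hρd := hdist.trans_le (min_le_left _ _)
    refine ⟨⟨hf₁.trans_lt hρd, hf₂.trans_lt hρd⟩, ?_⟩
    have hq := sqrt_misalignment_le_infDist hσ h₁ h₂ hy
    have hCd := hdist.trans_le (min_le_right _ _)
    rw [lt_div_iff₀ hC0] at hCd
    have h1 : Real.sqrt (misalignment σ y) ≤ 1 := by linarith
    simpa using Real.sqrt_le_iff.1 h1 |>.2
  obtain ⟨δ, hδ, hstay⟩ := hstable (min ρ (1 / C)) (by positivity)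
  obtain ⟨x₀, hx₀, hq0, hdist⟩ := exists_misalignment_pos_infDist_lt hσ h₁ h₂ hδ
  have hsol : ∀ T ≥ 0, ∀ x : ℝ → RelState, x 0 = x₀ →
      IsSolutionOn (relSpace d₁ d₂) (closedLoopField c) (Icc 0 T) x →
      ∀ t ∈ Icc 0 T, (|(x t).2.2.1 - e| < ρ ∧ |(x t).2.2.2 - e| < ρ) ∧
        misalignment σ (x t) ≤ 1 := fun T hT x hx0 hx t ht =>
    hnear _ (hx t ht).1 (hstay T hT x hx (by rw [hx0]; exact hdist) t ht)
  -- On the degenerate interval `[0, 0]` every curve through `x₀` is a solution, so the bounds hold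
  -- at `x₀` itself.
  have hstart := hsol 0 le_rfl (fun _ => x₀) rfl (fun t _ => ⟨hx₀, by
    have : Icc (0 : ℝ) 0 = {0} := Icc_self 0
    rw [this]
    exact hasDerivWithinAt_iff_hasFDerivWithinAt.2 (.of_subsingleton subsingleton_singleton)⟩) 0 ⟨le_rfl, le_rfl⟩
  obtain ⟨x, hx0, hx, -⟩ := exists_isSolutionOn_closedLoop (c := c) hρ₁ hρ₂ hx₀
    hstart.1.1.le hstart.1.2.le
    (fun T hT x hx0 hx _ => (hsol T hT x hx0 hx T ⟨hT, le_rfl⟩).1)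
  -- At this time `q₀ exp(mT) ≥ q₀(1 + mT) = q₀ + 1 > 1`.
  set T := 1 / (misalignment σ x₀ * m) with hT
  have hT0 : 0 < T := by positivity
  have hxT : IsSolutionOn (relSpace d₁ d₂) (closedLoopField c) (Icc 0 T) x :=
    fun t ht => ⟨(hx t ht.1).1, (hx t ht.1).2.mono Icc_subset_Ici_self⟩
  have hgrow := le_mul_exp_of_deriv_le (φ := fun s => -misalignment σ (x s)) (r := -m) (T := T)
    (fun s hs => (hasDerivWithinAt_misalignment (e := e) hσ hxT hs).neg) (fun s hs => by
      have hM := (hxT s hs).1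
      obtain ⟨⟨hf₁, hf₂⟩, hq1⟩ := hsol T hT0.le x hx0 hxT s hs
      have hS := turning_rate_bounds hσ' hkdef hk0 hρk hρ₁ hρ₂ hM hf₁.le hf₂.le
      rw [← hmdef] at hS
      have hqn := misalignment_nonneg hσ hM
      simp only [neg_mul, neg_div, neg_neg] at hS ⊢
      nlinarith [mul_nonneg hqn (sub_nonneg.2 hq1), mul_le_mul_of_nonneg_left hS hqn,
        mul_nonneg (mul_nonneg hqn (sub_nonneg.2 hq1)) (hm.le.trans hS)])
    (t := T) ⟨hT0.le, le_rfl⟩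
  have hle := (hsol T hT0.le x hx0 hxT T ⟨hT0.le, le_rfl⟩).2
  rw [hx0, neg_neg] at hgrow
  have hmT : misalignment σ x₀ * (m * T) = 1 := by rw [hT]; field_simp
  nlinarith [Real.add_one_le_exp (m * T)]

end StabilityOfCollinearSets

end FlexibleFormation

theorem proposition2 (d₁ d₂ c : ℝ) (hd₁ : 0 < d₁) (hd₂ : 0 < d₂) :
    -- the closed loop and the augmented error system come from the biased formation
    (∀ (T : ℝ) (p : ℝ → Positions),
      IsSolutionOn positionSpace (biasedField d₁ d₂ c (-c)) (Icc 0 T) p →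
        IsSolutionOn (relSpace d₁ d₂) (closedLoopField c) (Icc 0 T)
          (fun t => relState d₁ d₂ (p t)) ∧
        ∀ d₃ : ℝ, (∀ t ∈ Icc 0 T, (p t).2.2 ≠ (p t).1) →
          ∀ t ∈ Icc 0 T, HasDerivWithinAt (fun s => augmentedError d₁ d₂ d₃ (p s))
            (augmentedField d₁ d₂ d₃ c (augmentedError d₁ d₂ d₃ (p t))) (Icc 0 T) t) ∧
    -- both sets consist of equilibria: at rest on `𝒰_d`, travelling on `𝒰_u`
    ((∀ x ∈ Ud d₁ d₂, closedLoopField c x = 0) ∧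
      (∀ x ∈ Uu d₁ d₂ c, closedLoopField c x = 0) ∧
      (∀ p : Positions, relState d₁ d₂ p ∈ Ud d₁ d₂ → biasedField d₁ d₂ c (-c) p = 0) ∧
      (∀ p : Positions, relState d₁ d₂ p ∈ Uu d₁ d₂ c →
        biasedField d₁ d₂ c (-c) p =
          ((2 * c / 3) • dirVec (p.1 - p.2.1), (2 * c / 3) • dirVec (p.1 - p.2.1),
            (2 * c / 3) • dirVec (p.1 - p.2.1)))) ∧
    -- positive `c`
    (0 < c →
      IsLocallyExpStableSet (relSpace d₁ d₂) (closedLoopField c) (Ud d₁ d₂) ∧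
      (2 * c / 3 < d₁ → 2 * c / 3 < d₂ →
        IsUnstableSet (relSpace d₁ d₂) (closedLoopField c) (Uu d₁ d₂ c))) ∧
    -- negative `c`
    (c < 0 →
      IsUnstableSet (relSpace d₁ d₂) (closedLoopField c) (Ud d₁ d₂) ∧
      IsLocallyExpStableSet (relSpace d₁ d₂) (closedLoopField c) (Uu d₁ d₂ c)) ∧
    -- linearization of the augmented error system at `𝒰_d`
    (augmentedField d₁ d₂ (d₁ + d₂) c 0 = 0 ∧
      DifferentiableAt ℝ (augmentedField d₁ d₂ (d₁ + d₂) c) 0 ∧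
      (jacobian (augmentedField d₁ d₂ (d₁ + d₂) c) 0).charpoly =
        (X + C 1) * (X + C 3) * (X + C (2 * c * ((d₁ + d₂) / (d₁ * d₂))))) := by
  have hUd : 0 < d₁ + 0 ∧ 0 < d₂ + 0 := by simpa using ⟨hd₁, hd₂⟩
  refine ⟨fun T p hp => ⟨isSolutionOn_relState hp, fun d₃ hne t ht =>
      hasDerivWithinAt_augmentedError hp d₃ ht (hne t ht)⟩,
    ⟨fun x hx => closedLoopField_eq_zero_of_mem_Ud hx,
      fun x hx => closedLoopField_eq_zero_of_mem_Uu hx,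
      fun p hp => biasedField_eq_zero_of_mem_Ud hp, fun p hp => biasedField_of_mem_Uu hp⟩,
    fun hc => ⟨?_, fun h₁ h₂ => ?_⟩, fun hc => ⟨?_, ?_⟩, augmentedField_zero hd₁ hd₂ c,
    (hasFDerivAt_augmentedField hd₁ hd₂ c).differentiableAt,
    charpoly_jacobian_augmentedField hd₁ hd₂ c⟩
  · rw [Ud_eq_collinearSet]
    exact isLocallyExpStableSet_collinearSet (Or.inl rfl) hUd.1 hUd.2 (by ring) (by linarith)
  · rw [Uu_eq_collinearSet]
    exact isUnstableSet_collinearSet (Or.inr rfl) (by linarith) (by linarith) (by linarith)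
  · rw [Ud_eq_collinearSet]
    exact isUnstableSet_collinearSet (Or.inl rfl) hUd.1 hUd.2 (by linarith)
  · rw [Uu_eq_collinearSet]
    exact isLocallyExpStableSet_collinearSet (Or.inr rfl) (by linarith) (by linarith) (by ring)
      (by linarith)
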